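/- Let $n\ge 1$, let $\mathbb F$ be an algebraically closed field with $\operatorname{char}\mathbb F\neq n$, let $T=\mathbb Z_n^2$ (written additively, as column vectors, with standard generators $a=(1,0)$, $b=(0,1)$), and let $\mathcal D=M_n(\mathbb F)=\bigoplus_{t\in T}\mathcal D_t$ be a $T$-grading with support $T$ in which every nonzero homogeneous element is invertible. Definitions. An involution $\psi$ of $\mathcal D$ (an $\mathbb F$-linear anti-automorphism with $\psi^2=1$) is $\tau$-homogeneous, for a bijection $\tau\colon T\to T$, if $\psi(\mathcal D_t)=\mathcal D_{\tau(t)}$ for all $t$; it is homogeneous if it is $\tau$-homogeneous for some bijection $\tau$. Homogeneous involutions $\psi,\psi'$ are equivalent if there are an algebra automorphism $\varphi$ of $\mathcal D$ and a bijection $\alpha\colon T\to T$ with $\varphi(\mathcal D_t)=\mathcal D_{\alpha(t)}$ for all $t$ and $\varphi\psi=\psi'\varphi$; they are isomorphic if this holds with $\alpha=\mathrm{id}$. For $2\times 2$ matrices over $\mathbb Z_n$, $A\sim B$ means $PAP^{-1}=B$ for some $P\in \mathrm{SL}_2(\mathbb Z_n)$. Put $$\theta_1=\begin{pmatrix}1&0\\0&-1\end{pmatrix},\quad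 \theta_2=\begin{pmatrix}0&1\\1&0\end{pmatrix},\quad \theta_3=\begin{pmatrix}1&2\\ \frac n2&-1\end{pmatrix}\ (\text{if }4\mid n).$$ There are $X_a\in\mathcal D_a$, $X_b\in\mathcal D_b$ and a primitive $n$-th root of unity $\varepsilon\in\mathbb F$ with $X_a^n=X_b^n=1$ and $X_aX_b=\varepsilon X_bX_a$; fix any such choice and put $X_{\alpha a+\beta b}=X_a^\alpha X_b^\beta$. For a matrix $\theta$ and $\lambda_a,\lambda_b\in\mathbb F^\times$, $(\theta,\lambda_a,\lambda_b)$ denotes the $\theta$-homogeneous involution with $X_a\mapsto\lambda_aX_{\theta(a)}$, $X_b\mapsto\lambda_bX_{\theta(b)}$, if it exists (it is then unique). Theorem. For every $\tau\in \mathrm{GL}_2(\mathbb Z_n)$ with $\det\tau=-1$ and $\operatorname{tr}\tau=0$ there is a $\tau$-homogeneous involution on $\mathcal D$. Moreover, all the triples listed below define homogeneous involutions, and, for every such $\tau$: 1. If $n$ is odd, every homogeneous involution is equivalent to $(\theta_1,1,1)$, and there is a unique isomorphism class of $\tau$-homogeneous involutions. 2. If $n$ is even and $4\nmid n$: (a)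 every homogeneous involution is equivalent to $(\theta_1,1,1)$, $(\theta_1,-1,\varepsilon)$ or $(\theta_2,1,1)$; (b) if $\tau\sim\theta_1$, there are exactly four isomorphism classes of $\tau$-homogeneous involutions; (c) if $\tau\sim\theta_2$, there is exactly one. 3. If $4\mid n$: (a) every homogeneous involution is equivalent to $(\theta_1,1,1)$, $(\theta_1,1,\varepsilon)$, $(\theta_1,-1,\varepsilon)$, $(\theta_2,1,1)$ or $(\theta_3,\varepsilon^{n/4},\varepsilon)$; (b) if $\tau\sim\theta_1$, there are exactly four isomorphism classes of $\tau$-homogeneous involutions; (c) if $\tau\sim\theta_2$, there is exactly one; (d) if $\tau\sim\theta_3$, there is exactly one. -/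

import Mathlib

section HomogeneousInvolutions

variable {F D G : Type*} [Field F] [Ring D] [Algebra F D]

/-- The support of a family of homogeneous components. -/
def gradingSupport (𝒜 : G → Submodule F D) : Set G := {g | 𝒜 g ≠ ⊥}

/-- Every nonzero homogeneous element is invertible. -/
def IsDivisionGrading (𝒜 : G → Submodule F D) : Prop :=
  ∀ g, ∀ x ∈ 𝒜 g, x ≠ 0 → IsUnit x

/-- An `F`-linear involution: a linear anti-multiplicative map whose square is the identity
(it is then automatically bijective and unital). -/
structure IsAlgInvolution (ψ : D →ₗ[F] D) : Prop where
  map_mul : ∀ x y, ψ (x * y) = ψ y * ψ x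
  involutive : ∀ x, ψ (ψ x) = x

/-- `ψ (𝒜 g) = 𝒜 (τ g)` for all `g` in the support. -/
def IsTauHomogeneous (𝒜 : G → Submodule F D) (τ : G → G) (ψ : D →ₗ[F] D) : Prop :=
  ∀ g ∈ gradingSupport 𝒜, (𝒜 g).map ψ = 𝒜 (τ g)

/-- A `τ`-homogeneous involution. -/
def IsTauInvolution (𝒜 : G → Submodule F D) (τ : G → G) (ψ : D →ₗ[F] D) : Prop :=
  IsAlgInvolution ψ ∧ IsTauHomogeneous 𝒜 τ ψ

/-- A homogeneous involution: one that is `τ`-homogeneous for some bijection `τ` of the grading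
group. -/
def IsHomogeneousInvolution (𝒜 : G → Submodule F D) (ψ : D →ₗ[F] D) : Prop :=
  ∃ τ : G ≃ G, IsTauInvolution 𝒜 τ ψ

/-- `ψ` and `ψ'` are equivalent: they are intertwined by an algebra automorphism that permutes
the nonzero homogeneous components. -/
def InvolutionsEquivalent (𝒜 : G → Submodule F D) (ψ ψ' : D →ₗ[F] D) : Prop :=
  ∃ φ : D ≃ₐ[F] D,
    (∃ α : gradingSupport 𝒜 ≃ gradingSupport 𝒜,
      ∀ g : gradingSupport 𝒜, (𝒜 g).map φ.toLinearMap = 𝒜 (α g)) ∧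
    ∀ x, φ (ψ x) = ψ' (φ x)

/-- `ψ` and `ψ'` are isomorphic: they are intertwined by a graded algebra automorphism. -/
def InvolutionsIsomorphic (𝒜 : G → Submodule F D) (ψ ψ' : D →ₗ[F] D) : Prop :=
  ∃ φ : D ≃ₐ[F] D,
    (∀ g ∈ gradingSupport 𝒜, (𝒜 g).map φ.toLinearMap = 𝒜 g) ∧
    ∀ x, φ (ψ x) = ψ' (φ x)

/-- Isomorphism, as an equivalence relation on the set of `τ`-homogeneous involutions. -/
def involutionSetoid (𝒜 : G → Submodule F D) (τ : G → G) :
    Setoid {ψ : D →ₗ[F] D // IsTauInvolution 𝒜 τ ψ} where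
  r ψ ψ' := InvolutionsIsomorphic 𝒜 ψ.1 ψ'.1
  iseqv :=
    { refl := fun ψ => ⟨AlgEquiv.refl, fun g _ => by ext x; simp, fun x => rfl⟩
      symm := by
        rintro ψ ψ' ⟨φ, hφ, h⟩
        refine ⟨φ.symm, fun g hg => ?_, fun x => ?_⟩
        · conv_lhs => rw [← hφ g hg]
          ext x
          simp
        · apply φ.injective
          rw [h, φ.apply_symm_apply, φ.apply_symm_apply]
      trans := by
        rintro ψ₁ ψ₂ ψ₃ ⟨φ, hφ, h⟩ ⟨φ', hφ', h'⟩
        refine ⟨φ.trans φ', fun g hg => ?_, fun x => ?_⟩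
        · conv_rhs => rw [← hφ' g hg, ← hφ g hg]
          ext x
          simp
        · rw [AlgEquiv.trans_apply, h, h', AlgEquiv.trans_apply] }

/-- The number of isomorphism classes of `τ`-homogeneous involutions
(`0` when there are infinitely many). -/
noncomputable def numIsoClasses (𝒜 : G → Submodule F D) (τ : G → G) : ℕ :=
  Nat.card (Quotient (involutionSetoid 𝒜 τ))

end HomogeneousInvolutions

section Pauli

/-- The group `T = ℤₙ²`, written additively as column vectors, with the standard generators
`a = (1, 0)` and `b = (0, 1)`. -/
abbrev PauliGroup (n : ℕ) : Type := Fin 2 → ZMod n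

def pauliA (n : ℕ) : PauliGroup n := ![1, 0]

def pauliB (n : ℕ) : PauliGroup n := ![0, 1]

/-- Two matrices lie in the same orbit of `SL₂(ℤₙ)` acting by conjugation. -/
def SLConj {n : ℕ} (A B : Matrix (Fin 2) (Fin 2) (ZMod n)) : Prop :=
  ∃ P : Matrix.SpecialLinearGroup (Fin 2) (ZMod n),
    (P : Matrix (Fin 2) (Fin 2) (ZMod n)) * A
      * ((P⁻¹ : Matrix.SpecialLinearGroup (Fin 2) (ZMod n)) : Matrix (Fin 2) (Fin 2) (ZMod n)) = B

def pauliTheta1 (n : ℕ) : Matrix (Fin 2) (Fin 2) (ZMod n) := !![1, 0; 0, -1]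

def pauliTheta2 (n : ℕ) : Matrix (Fin 2) (Fin 2) (ZMod n) := !![0, 1; 1, 0]

/-- Used only for `4 ∣ n`, so that `n / 2` is an exact division. -/
def pauliTheta3 (n : ℕ) : Matrix (Fin 2) (Fin 2) (ZMod n) := !![1, 2; ((n / 2 : ℕ) : ZMod n), -1]

variable {F D : Type*} [Field F] [Ring D] [Algebra F D] {n : ℕ}

/-- `Xa ∈ 𝒜 a` and `Xb ∈ 𝒜 b` are standard generators, with `Xaⁿ = Xbⁿ = 1` and
`Xa Xb = ε Xb Xa`, where `ε` is a primitive `n`-th root of unity. -/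
structure IsPauliGenerators (𝒜 : PauliGroup n → Submodule F D) (ε : F) (Xa Xb : D) : Prop where
  mem_a : Xa ∈ 𝒜 (pauliA n)
  mem_b : Xb ∈ 𝒜 (pauliB n)
  pow_a : Xa ^ n = 1
  pow_b : Xb ^ n = 1
  primitive : IsPrimitiveRoot ε n
  comm : Xa * Xb = ε • (Xb * Xa)

/-- The homogeneous element `X_{αa + βb} = Xa ^ α * Xb ^ β`. -/
def pauliMonomial (Xa Xb : D) (t : PauliGroup n) : D := Xa ^ (t 0).val * Xb ^ (t 1).val

/-- `ψ` is the homogeneous involution `(θ, la, lb)`, i.e. the `θ`-homogeneous involution with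
`Xa ↦ la X_{θ(a)}` and `Xb ↦ lb X_{θ(b)}`. -/
structure IsPauliForm (𝒜 : PauliGroup n → Submodule F D) (Xa Xb : D)
    (θ : Matrix (Fin 2) (Fin 2) (ZMod n)) (la lb : F) (ψ : D →ₗ[F] D) : Prop where
  isTauInvolution : IsTauInvolution 𝒜 θ.mulVec ψ
  map_a : ψ Xa = la • pauliMonomial Xa Xb (θ.mulVec (pauliA n))
  map_b : ψ Xb = lb • pauliMonomial Xa Xb (θ.mulVec (pauliB n))

/-- Each triple `(θ, la, lb)` in the list `L` defines one and only one homogeneous involution,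
and every homogeneous involution is equivalent to one of those. -/
def HasNormalForms (𝒜 : PauliGroup n → Submodule F D) (Xa Xb : D)
    (L : List (Matrix (Fin 2) (Fin 2) (ZMod n) × F × F)) : Prop :=
  (∀ p ∈ L, ∃! ψ, IsPauliForm 𝒜 Xa Xb p.1 p.2.1 p.2.2 ψ) ∧
  ∀ ψ, IsHomogeneousInvolution 𝒜 ψ →
    ∃ p ∈ L, ∃ ψ', IsPauliForm 𝒜 Xa Xb p.1 p.2.1 p.2.2 ψ' ∧ InvolutionsEquivalent 𝒜 ψ ψ'

end Pauli

/-! With generators satisfying X^n = Y^n = 1 and XY = εYX, the n² monomials X_t form a basis of D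
and every component is a line. So D is presented by these relations: homomorphisms and
anti-homomorphisms out of D are determined by the images of X and Y, and exist as soon as those
images satisfy the (reversed) relations (`exists_algHom`, `exists_antiHom`).

Homogeneous elements of degrees s and t commute up to ε^det(s,t). Hence a homogeneous involution
acts on T by a linear map of determinant -1, and since its square is 1, Cayley–Hamilton kills the
trace (`exists_matrix_of_isTauInvolution`). Every matrix in SL₂(ℤₙ) is induced by an automorphism
(`exists_algEquiv_map`), so only the SL₂-conjugacy class of τ matters. By the Chinese remainder
theorem these classes are decided at prime powers. At odd primes there is only θ₁. At 2, an odd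
off-diagonal entry gives θ₂; otherwise τ is conjugate to (1, 2; c, -1) with 2c = 0, which yields θ₁
or, if 4 ∣ n, θ₃ (`slConj_classification_even`).

It remains to compare coefficients for each θᵢ. Graded automorphisms are X ↦ κX, Y ↦ μY with κ^n =
μ^n = 1 (`isomorphic_iff`). For θ₁, la² = la^n = lb^n = 1 and lb matters only up to squares of n-th
roots of unity: one class for n odd, four for n even, separated by la and lb^(n/2). For θ₂ (la·lb =
1) and θ₃ (la² = lb^(n/2) = -1) the rescalings act transitively. Automorphisms that permute the
components, X ↦ cXY^(n/2) and, for n/2 odd, Y ↦ κYX^(n/2), merge some of the θ₁ classes up to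
equivalence. -/

section PauliRelations

/-! ### Monomials in two ε-commuting elements -/

variable {F D : Type*} [Field F] [Ring D] [Algebra F D] {n : ℕ}

theorem pow_val_natCast {M : Type*} [Monoid M] {x : M} (hx : x ^ n = 1) (k : ℕ) :
    x ^ (k : ZMod n).val = x ^ k := by
  rw [ZMod.val_natCast, ← pow_eq_pow_mod _ hx]

theorem pow_val_add [NeZero n] {M : Type*} [Monoid M] {x : M} (hx : x ^ n = 1) (a b : ZMod n) :
    x ^ (a + b).val = x ^ a.val * x ^ b.val := by
  rw [ZMod.val_add, ← pow_eq_pow_mod _ hx, pow_add]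

theorem pow_val_mul {M : Type*} [Monoid M] {x : M} (hx : x ^ n = 1) (a b : ZMod n) :
    x ^ (a * b).val = x ^ (a.val * b.val) := by
  rw [ZMod.val_mul, ← pow_eq_pow_mod _ hx]

theorem pow_mul_comm_smul {ε : F} {x y : D} (h : x * y = ε • (y * x)) (i : ℕ) :
    x ^ i * y = ε ^ i • (y * x ^ i) := by
  induction i with
  | zero => simp
  | succ i ih =>
    rw [pow_succ, mul_assoc, h, mul_smul_comm, ← mul_assoc, ih, smul_mul_assoc, smul_smul,
      mul_assoc, pow_succ']

theorem pow_mul_pow_comm_smul {ε : F} {x y : D} (h : x * y = ε • (y * x)) (i j : ℕ) :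
    x ^ i * y ^ j = ε ^ (i * j) • (y ^ j * x ^ i) := by
  induction j with
  | zero => simp
  | succ j ih =>
    rw [pow_succ, ← mul_assoc, ih, smul_mul_assoc, mul_assoc, pow_mul_comm_smul h, mul_smul_comm,
      smul_smul, ← pow_add, mul_assoc, Nat.mul_succ]

/-- The scalar is the cost of moving `y ^ (s 1)` past `x ^ (t 0)`; it stands on the side where no
inverse of `ε` is needed. Exponents may wrap modulo `n` because `x ^ n = y ^ n = 1`. -/
theorem pauliMonomial_mul [NeZero n] {ε : F} {x y : D} (hx : x ^ n = 1) (hy : y ^ n = 1)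
    (h : x * y = ε • (y * x)) (s t : PauliGroup n) :
    ε ^ ((t 0).val * (s 1).val) • (pauliMonomial x y s * pauliMonomial x y t) =
      pauliMonomial x y (s + t) := by
  simp only [pauliMonomial, Pi.add_apply, pow_val_add hx, pow_val_add hy]
  calc _ = x ^ (s 0).val * (ε ^ ((t 0).val * (s 1).val) • (y ^ (s 1).val * x ^ (t 0).val))
        * y ^ (t 1).val := by
          simp only [mul_smul_comm, smul_mul_assoc, mul_assoc]
    _ = _ := by rw [← pow_mul_pow_comm_smul h]; simp only [mul_assoc]

@[simp] theorem pauliMonomial_zero (x y : D) : pauliMonomial x y (0 : PauliGroup n) = 1 := by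
  simp [pauliMonomial]

theorem isUnit_pauliMonomial [NeZero n] {x y : D} (hx : x ^ n = 1) (hy : y ^ n = 1)
    (t : PauliGroup n) : IsUnit (pauliMonomial x y t) :=
  ((IsUnit.of_pow_eq_one hx (NeZero.ne n)).pow _).mul ((IsUnit.of_pow_eq_one hy (NeZero.ne n)).pow _)

theorem pauliGroup_eq (t : PauliGroup n) : t = t 0 • pauliA n + t 1 • pauliB n := by
  funext i
  fin_cases i <;> simp [pauliA, pauliB]

theorem pauliMonomial_A {x y : D} (hx : x ^ n = 1) : pauliMonomial x y (pauliA n) = x := by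
  have := pow_val_natCast hx 1
  simpa [pauliMonomial, pauliA] using this

theorem pauliMonomial_B {x y : D} (hy : y ^ n = 1) : pauliMonomial x y (pauliB n) = y := by
  have := pow_val_natCast hy 1
  simpa [pauliMonomial, pauliB] using this

/-- The alternating form on `ℤₙ²` given by the determinant. -/
def pauliForm (s t : PauliGroup n) : ZMod n := s 0 * t 1 - s 1 * t 0

theorem smul_pow_eq_one {c : F} {x : D} {m : ℕ} (hc : c ^ m = 1) (hx : x ^ m = 1) :
    (c • x) ^ m = 1 := by
  rw [smul_pow, hc, hx, one_smul]

end PauliRelations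

/-! ### Components are lines; existence of standard generators -/

section OneDimensional

variable {F D : Type*} [Field F] [Ring D] [Algebra F D] {n : ℕ} [NeZero n]
  {𝒜 : PauliGroup n → Submodule F D} [GradedAlgebra 𝒜]

theorem eq_of_mem_graded {ι : Type*} [DecidableEq ι] [AddMonoid ι] {ℬ : ι → Submodule F D}
    [GradedAlgebra ℬ] {s t : ι} {x : D} (hs : x ∈ ℬ s) (ht : x ∈ ℬ t) (hx : x ≠ 0) : s = t :=
  DirectSum.degree_eq_of_mem_mem ℬ hs ht hx

omit [NeZero n] in
theorem linearIndependent_of_mem_graded {v : PauliGroup n → D} (hv : ∀ t, v t ∈ 𝒜 t)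
    (hv0 : ∀ t, v t ≠ 0) : LinearIndependent F v :=
  (DirectSum.Decomposition.isInternal 𝒜).submodule_iSupIndep.linearIndependent 𝒜 hv hv0

/-- A choice of a nonzero vector in each component of the grading, as a basis. -/
noncomputable def homogeneousBasis (hD : Module.finrank F D = n ^ 2) {v : PauliGroup n → D}
    (hv : ∀ t, v t ∈ 𝒜 t) (hv0 : ∀ t, v t ≠ 0) : Module.Basis (PauliGroup n) F D :=
  basisOfLinearIndependentOfCardEqFinrank (linearIndependent_of_mem_graded hv hv0)
    (by simp [hD, ZMod.card])

theorem homogeneousBasis_apply (hD : Module.finrank F D = n ^ 2) {v : PauliGroup n → D}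
    (hv : ∀ t, v t ∈ 𝒜 t) (hv0 : ∀ t, v t ≠ 0) (t : PauliGroup n) :
    homogeneousBasis hD hv hv0 t = v t := by
  simp [homogeneousBasis]

/-- The n² vectors `v s` are independent, hence a basis; projecting an expansion to degree `t`
leaves only the term at `t`. -/
theorem graded_eq_span (hD : Module.finrank F D = n ^ 2) {v : PauliGroup n → D}
    (hv : ∀ t, v t ∈ 𝒜 t) (hv0 : ∀ t, v t ≠ 0) (t : PauliGroup n) : 𝒜 t = F ∙ v t := by
  apply le_antisymm
  · intro x hx
    set b := homogeneousBasis hD hv hv0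
    have h1 := b.sum_repr x
    have h2 : GradedRing.proj 𝒜 t x = x := by
      rw [GradedRing.proj_apply, DirectSum.decompose_of_mem_same 𝒜 hx]
    rw [← h1, map_sum, Finset.sum_eq_single t] at h2
    · have h3 : GradedRing.proj 𝒜 t (b.repr x t • b t) = b.repr x t • b t := by
        rw [GradedRing.proj_apply, DirectSum.decompose_of_mem_same 𝒜]
        exact Submodule.smul_mem _ _ (by rw [homogeneousBasis_apply]; exact hv t)
      rw [h1, h3, homogeneousBasis_apply] at h2
      exact Submodule.mem_span_singleton.2 ⟨_, h2⟩
    · intro s _ hs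
      rw [GradedRing.proj_apply, DirectSum.decompose_of_mem_ne 𝒜 (i := s) _ hs]
      exact Submodule.smul_mem _ _ (by rw [homogeneousBasis_apply]; exact hv s)
    · simp
  · rw [Submodule.span_singleton_le_iff_mem]
    exact hv t

omit [NeZero n] [GradedAlgebra 𝒜] in
theorem exists_ne_zero_mem_of_support (hsupp : gradingSupport 𝒜 = Set.univ) (t : PauliGroup n) :
    ∃ v ∈ 𝒜 t, v ≠ 0 := by
  have : t ∈ gradingSupport 𝒜 := by simp [hsupp]
  exact Submodule.exists_mem_ne_zero_of_ne_bot this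

theorem mem_graded_smul (hD : Module.finrank F D = n ^ 2)
    (hsupp : gradingSupport 𝒜 = Set.univ) {t : PauliGroup n} {x y : D}
    (hx : x ∈ 𝒜 t) (hx0 : x ≠ 0) (hy : y ∈ 𝒜 t) : ∃ c : F, y = c • x := by
  choose v hv hv0 using exists_ne_zero_mem_of_support hsupp
  classical
  have := graded_eq_span hD (v := Function.update v t x)
    (fun s => by by_cases h : s = t <;> [(subst h; simpa); simpa [h] using hv s])
    (fun s => by by_cases h : s = t <;> [(subst h; simpa); simpa [h] using hv0 s]) t
  rw [this, Function.update_self] at hy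
  obtain ⟨c, hc⟩ := Submodule.mem_span_singleton.1 hy
  exact ⟨c, hc.symm⟩

/-- Since `n • t = 0`, the power `x ^ n` lies in the line spanned by 1, and algebraic closedness
supplies the n-th root needed to rescale it to 1. -/
theorem exists_pow_eq_one_of_mem_graded [IsAlgClosed F] [Nontrivial D]
    (hD : Module.finrank F D = n ^ 2) (hsupp : gradingSupport 𝒜 = Set.univ) {t : PauliGroup n}
    {x : D} (hx : x ∈ 𝒜 t) (hu : IsUnit x) : ∃ c : F, c ≠ 0 ∧ (c • x) ^ n = 1 := by
  have h0 : x ^ n ∈ 𝒜 0 := by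
    have := SetLike.pow_mem_graded n hx
    simpa using this
  obtain ⟨c, hc⟩ := mem_graded_smul hD hsupp SetLike.GradedOne.one_mem one_ne_zero h0
  have hc0 : c ≠ 0 := by
    rintro rfl
    have := hu.pow n
    rw [hc, zero_smul] at this
    exact not_isUnit_zero this
  obtain ⟨z, hz⟩ := IsAlgClosed.exists_pow_nat_eq c⁻¹ (NeZero.pos n)
  refine ⟨z, ?_, ?_⟩
  · rintro rfl
    rw [zero_pow (NeZero.ne n)] at hz
    exact inv_ne_zero hc0 hz.symm
  · rw [smul_pow, hz, hc, smul_smul, inv_mul_cancel₀ hc0, one_smul]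

theorem pauliMonomial_mem {x y : D} {s t : PauliGroup n} (hx : x ∈ 𝒜 s) (hy : y ∈ 𝒜 t)
    (r : PauliGroup n) : pauliMonomial x y r ∈ 𝒜 (r 0 • s + r 1 • t) := by
  have := SetLike.mul_mem_graded (SetLike.pow_mem_graded (r 0).val hx)
    (SetLike.pow_mem_graded (r 1).val hy)
  have e : r 0 • s + r 1 • t = (r 0).val • s + (r 1).val • t := by
    funext i
    simp only [Pi.add_apply, Pi.smul_apply, smul_eq_mul]
    simp only [nsmul_eq_mul, ZMod.natCast_zmod_val]
  rw [e]
  exact this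

theorem exists_isPauliGenerators [IsAlgClosed F] [Nontrivial D] [Algebra.IsCentral F D]
    (hD : Module.finrank F D = n ^ 2) (hdiv : IsDivisionGrading 𝒜)
    (hsupp : gradingSupport 𝒜 = Set.univ) :
    ∃ (ε : F) (X Y : D), IsPauliGenerators 𝒜 ε X Y := by
  have key : ∀ t : PauliGroup n, ∃ x ∈ 𝒜 t, x ^ n = 1 := fun t => by
    obtain ⟨x, hx, hx0⟩ := exists_ne_zero_mem_of_support hsupp t
    obtain ⟨c, -, hc⟩ := exists_pow_eq_one_of_mem_graded hD hsupp hx (hdiv t x hx hx0)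
    exact ⟨c • x, Submodule.smul_mem _ _ hx, hc⟩
  obtain ⟨X, hXm, hX⟩ := key (pauliA n)
  obtain ⟨Y, hYm, hY⟩ := key (pauliB n)
  have hXu := IsUnit.of_pow_eq_one hX (NeZero.ne n)
  have hYu := IsUnit.of_pow_eq_one hY (NeZero.ne n)
  have hYX : Y * X ∈ 𝒜 (pauliA n + pauliB n) := by
    rw [add_comm]; exact SetLike.mul_mem_graded hYm hXm
  obtain ⟨ε, hε⟩ := mem_graded_smul hD hsupp hYX (hYu.mul hXu).ne_zero
    (SetLike.mul_mem_graded hXm hYm)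
  have hcomm (k : ℕ) : X ^ k * Y = ε ^ k • (Y * X ^ k) := pow_mul_comm_smul hε k
  refine ⟨ε, X, Y, hXm, hYm, hX, hY, ⟨?_, ?_⟩, hε⟩
  · have h := hcomm n
    rw [hX, one_mul, mul_one] at h
    have h' : (ε ^ n - 1) • Y = 0 := by rw [sub_smul, one_smul, ← h, sub_self]
    rcases smul_eq_zero.1 h' with h' | h'
    · exact sub_eq_zero.1 h'
    · exact absurd h' hYu.ne_zero
  -- If `ε ^ l = 1` then `X ^ l` commutes with both generators, so it is central, hence a scalar of
  -- degree 0. Its degree is also `l • a`, which forces `n ∣ l`.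
  · intro l hl
    have hY' : Commute (X ^ l) Y := by
      have := hcomm l
      rwa [hl, one_smul] at this
    have hX' : Commute (X ^ l) X := (Commute.refl X).pow_left l
    have hv (t : PauliGroup n) : pauliMonomial X Y t ∈ 𝒜 t := by
      convert pauliMonomial_mem hXm hYm t
      exact pauliGroup_eq t
    have hcen : X ^ l ∈ Subalgebra.center F D := by
      rw [Subalgebra.mem_center_iff]
      intro z
      let b := homogeneousBasis hD hv (fun t => (isUnit_pauliMonomial hX hY t).ne_zero)
      have : LinearMap.mulRight F (X ^ l) = LinearMap.mulLeft F (X ^ l) := by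
        apply b.ext
        intro t
        rw [homogeneousBasis_apply]
        exact ((hX'.pow_right _).mul_right (hY'.pow_right _)).symm
      exact LinearMap.congr_fun this z
    rw [Algebra.IsCentral.center_eq_bot, Algebra.mem_bot] at hcen
    obtain ⟨c, hc⟩ := hcen
    have h0 : X ^ l ∈ 𝒜 0 := by
      rw [← hc, Algebra.algebraMap_eq_smul_one]
      exact Submodule.smul_mem _ _ SetLike.GradedOne.one_mem
    have := eq_of_mem_graded h0 (SetLike.pow_mem_graded l hXm) (hXu.pow l).ne_zero
    have := congrFun this 0
    simp only [pauliA, Pi.zero_apply, Pi.smul_apply, Matrix.cons_val_zero, nsmul_eq_mul,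
      mul_one] at this
    exact (ZMod.natCast_eq_zero_iff l n).1 this.symm

end OneDimensional

/-! ### Linear anti-endomorphisms -/

section AntiHom

variable {F D : Type*} [Field F] [Ring D] [Algebra F D] {ψ : D →ₗ[F] D}

/-- A unital linear anti-endomorphism. -/
structure IsAntiHom (ψ : D →ₗ[F] D) : Prop where
  map_mul : ∀ x y, ψ (x * y) = ψ y * ψ x
  map_one : ψ 1 = 1

theorem IsAntiHom.map_pow (h : IsAntiHom ψ) (x : D) (k : ℕ) : ψ (x ^ k) = ψ x ^ k := by
  induction k with
  | zero => simpa using h.map_one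
  | succ k ih => rw [pow_succ, h.map_mul, ih, pow_succ']

theorem IsAntiHom.map_pauliMonomial (h : IsAntiHom ψ) {n : ℕ} (x y : D) (t : PauliGroup n) :
    ψ (pauliMonomial x y t) = ψ y ^ (t 1).val * ψ x ^ (t 0).val := by
  simp only [pauliMonomial, h.map_mul, h.map_pow]

theorem IsAlgInvolution.isAntiHom (h : IsAlgInvolution ψ) : IsAntiHom ψ where
  map_mul := h.map_mul
  map_one := by
    have := h.map_mul (ψ 1) 1
    rw [mul_one, h.involutive, mul_one] at this
    exact this.symm

theorem IsAlgInvolution.injective (h : IsAlgInvolution ψ) : Function.Injective ψ :=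
  Function.LeftInverse.injective h.involutive

end AntiHom

/-! ### The presentation of D and the maps it produces -/

namespace IsPauliGenerators

variable {F D : Type*} [Field F] [Ring D] [Algebra F D] {n : ℕ} [NeZero n]
  {𝒜 : PauliGroup n → Submodule F D} {ε : F} {X Y : D}

section Lift

variable [GradedAlgebra 𝒜] (h : IsPauliGenerators 𝒜 ε X Y)
include h

theorem monomial_mem (t : PauliGroup n) : pauliMonomial X Y t ∈ 𝒜 t := by
  have := pauliMonomial_mem h.mem_a h.mem_b t
  rwa [← pauliGroup_eq t] at this

omit [GradedAlgebra 𝒜] in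
theorem isUnit_monomial (t : PauliGroup n) : IsUnit (pauliMonomial X Y t) :=
  isUnit_pauliMonomial h.pow_a h.pow_b t

theorem span_monomial [Nontrivial D] (hD : Module.finrank F D = n ^ 2) (t : PauliGroup n) :
    𝒜 t = F ∙ pauliMonomial X Y t :=
  graded_eq_span hD h.monomial_mem (fun t => (h.isUnit_monomial t).ne_zero) t

/-- The monomials `X ^ α * Y ^ β` as a basis. -/
noncomputable def basis [Nontrivial D] (hD : Module.finrank F D = n ^ 2) :
    Module.Basis (PauliGroup n) F D :=
  homogeneousBasis hD h.monomial_mem (fun t => (h.isUnit_monomial t).ne_zero)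

theorem basis_apply [Nontrivial D] (hD : Module.finrank F D = n ^ 2) (t : PauliGroup n) :
    h.basis hD t = pauliMonomial X Y t :=
  homogeneousBasis_apply ..

/-- The linear map matching monomials is multiplicative because `pauliMonomial_mul` gives the same
structure constants on both sides. The target is a general `E` so that it can be the opposite
algebra. -/
theorem exists_algHom [Nontrivial D] (hD : Module.finrank F D = n ^ 2) {E : Type*} [Ring E]
    [Algebra F E] {x y : E} (hx : x ^ n = 1) (hy : y ^ n = 1) (hxy : x * y = ε • (y * x)) :
    ∃ f : D →ₐ[F] E, f X = x ∧ f Y = y := by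
  let f := (h.basis hD).constr F (pauliMonomial x y)
  have hf (t : PauliGroup n) : f (pauliMonomial X Y t) = pauliMonomial x y t := by
    rw [← h.basis_apply hD, Module.Basis.constr_basis]
  have hε : ε ≠ 0 := h.primitive.ne_zero (NeZero.ne n)
  have hmul : (LinearMap.mul F D).compr₂ f = (LinearMap.mul F E).compl₁₂ f f := by
    apply (h.basis hD).ext
    intro s
    apply (h.basis hD).ext
    intro t
    simp only [basis_apply, LinearMap.compr₂_apply, LinearMap.mul_apply', LinearMap.compl₁₂_apply,
      hf]
    have h1 := congrArg f (pauliMonomial_mul h.pow_a h.pow_b h.comm s t)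
    rw [hf, ← pauliMonomial_mul hx hy hxy, map_smul] at h1
    exact smul_right_injective E (pow_ne_zero _ hε) h1
  refine ⟨AlgHom.ofLinearMap f ?_ ?_, ?_, ?_⟩
  · simpa using hf 0
  · intro a b
    exact LinearMap.congr_fun₂ hmul a b
  · have := hf (pauliA n)
    rwa [pauliMonomial_A h.pow_a, pauliMonomial_A hx] at this
  · have := hf (pauliB n)
    rwa [pauliMonomial_B h.pow_b, pauliMonomial_B hy] at this

theorem linearMap_ext [Nontrivial D] (hD : Module.finrank F D = n ^ 2) {E : Type*}
    [AddCommGroup E] [Module F E] {f g : D →ₗ[F] E}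
    (hfg : ∀ t : PauliGroup n, f (pauliMonomial X Y t) = g (pauliMonomial X Y t)) : f = g :=
  (h.basis hD).ext fun t => by rw [basis_apply, hfg]

/-- For monomials, both products are multiples of the same monomial of degree `s + t`; the ratio of
the two scalars is `ε` to the power of the determinant form. Scaling does not affect it. -/
theorem mul_comm_of_mem [Nontrivial D] (hD : Module.finrank F D = n ^ 2) {s t : PauliGroup n}
    {u v : D} (hu : u ∈ 𝒜 s) (hv : v ∈ 𝒜 t) : u * v = ε ^ (pauliForm s t).val • (v * u) := by
  have hε : ε ≠ 0 := h.primitive.ne_zero (NeZero.ne n)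
  have hε1 : ε ^ n = 1 := h.primitive.pow_eq_one
  rw [h.span_monomial hD] at hu hv
  obtain ⟨c, rfl⟩ := Submodule.mem_span_singleton.1 hu
  obtain ⟨d, rfl⟩ := Submodule.mem_span_singleton.1 hv
  have h1 := pauliMonomial_mul h.pow_a h.pow_b h.comm s t
  have h2 := pauliMonomial_mul h.pow_a h.pow_b h.comm t s
  rw [add_comm, ← h1, ← pow_val_mul hε1, ← pow_val_mul hε1] at h2
  have h3 : ε ^ (s 0 * t 1).val = ε ^ (pauliForm s t).val * ε ^ (t 0 * s 1).val := by
    rw [← pow_val_add hε1, pauliForm]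
    congr 2
    ring
  rw [h3, mul_comm (ε ^ (pauliForm s t).val), mul_smul] at h2
  have h4 := smul_right_injective D (pow_ne_zero _ hε) h2
  simp only [smul_mul_smul_comm, smul_comm _ (d * c)]
  rw [← h4, mul_comm]

/-- Simplicity makes the homomorphism injective, and finite dimension then makes it bijective. -/
theorem exists_algEquiv [IsSimpleRing D] (hD : Module.finrank F D = n ^ 2)
    {x y : D} (hx : x ^ n = 1) (hy : y ^ n = 1) (hxy : x * y = ε • (y * x)) :
    ∃ f : D ≃ₐ[F] D, f X = x ∧ f Y = y := by
  obtain ⟨f, hfX, hfY⟩ := h.exists_algHom hD hx hy hxy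
  have : FiniteDimensional F D := Module.Finite.of_basis (h.basis hD)
  have hf : Function.Injective f := f.toRingHom.injective
  exact ⟨AlgEquiv.ofBijective f ⟨hf, LinearMap.surjective_of_injective (f := f.toLinearMap) hf⟩,
    hfX, hfY⟩

theorem support_eq [Nontrivial D] : gradingSupport 𝒜 = Set.univ := by
  ext s
  simp only [gradingSupport, Set.mem_ofPred_eq, Set.mem_univ, iff_true]
  intro h0
  have := h.monomial_mem s
  rw [h0, Submodule.mem_bot] at this
  exact (h.isUnit_monomial s).ne_zero this

theorem map_graded_of_linearMap [Nontrivial D] (hD : Module.finrank F D = n ^ 2) {f : D →ₗ[F] D}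
    {μ : PauliGroup n → PauliGroup n} (h1 : ∀ t, f (pauliMonomial X Y t) ∈ 𝒜 (μ t))
    (h2 : ∀ t : PauliGroup n, f (pauliMonomial X Y t) ≠ 0) (t : PauliGroup n) :
    (𝒜 t).map f = 𝒜 (μ t) := by
  rw [h.span_monomial hD t, Submodule.map_span, Set.image_singleton]
  apply le_antisymm
  · rw [Submodule.span_singleton_le_iff_mem]
    exact h1 t
  · intro y hy
    obtain ⟨c, rfl⟩ := mem_graded_smul hD h.support_eq (h1 t) (h2 t) hy
    exact Submodule.mem_span_singleton.2 ⟨c, rfl⟩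

theorem map_graded [IsSimpleRing D] (hD : Module.finrank F D = n ^ 2) (f : D ≃ₐ[F] D)
    {M : Matrix (Fin 2) (Fin 2) (ZMod n)}
    (hX : f X ∈ 𝒜 (M.mulVec (pauliA n))) (hY : f Y ∈ 𝒜 (M.mulVec (pauliB n)))
    (t : PauliGroup n) : (𝒜 t).map f.toLinearMap = 𝒜 (M.mulVec t) := by
  refine h.map_graded_of_linearMap hD (fun t => ?_) (fun t => ?_) t
  · have := pauliMonomial_mem hX hY t
    rw [← Matrix.mulVec_smul, ← Matrix.mulVec_smul, ← Matrix.mulVec_add, ← pauliGroup_eq] at this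
    simpa [pauliMonomial] using this
  · simpa using (h.isUnit_monomial t).ne_zero

/-- Determinant 1 preserves the alternating form, so normalized elements in degrees `M a` and `M b`
again satisfy the relation with the same `ε`. -/
theorem exists_algEquiv_map [IsAlgClosed F] [IsSimpleRing D] (hD : Module.finrank F D = n ^ 2)
    {M : Matrix (Fin 2) (Fin 2) (ZMod n)} (hM : M.det = 1) :
    ∃ f : D ≃ₐ[F] D, ∀ t : PauliGroup n, (𝒜 t).map f.toLinearMap = 𝒜 (M.mulVec t) := by
  have key : ∀ t : PauliGroup n, ∃ x ∈ 𝒜 t, x ^ n = 1 := fun t => by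
    obtain ⟨c, -, hc⟩ := exists_pow_eq_one_of_mem_graded hD h.support_eq (h.monomial_mem t)
      (h.isUnit_monomial t)
    exact ⟨_, Submodule.smul_mem _ _ (h.monomial_mem t), hc⟩
  obtain ⟨x, hxm, hx⟩ := key (M.mulVec (pauliA n))
  obtain ⟨y, hym, hy⟩ := key (M.mulVec (pauliB n))
  have hxy := h.mul_comm_of_mem hD hxm hym
  have : pauliForm (M.mulVec (pauliA n)) (M.mulVec (pauliB n)) = 1 := by
    rw [← hM, Matrix.det_fin_two]
    simp [pauliForm, pauliA, pauliB, Matrix.mulVec, dotProduct]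
    ring
  have hε1 := pow_val_natCast h.primitive.pow_eq_one 1
  rw [Nat.cast_one, pow_one] at hε1
  rw [this, hε1] at hxy
  obtain ⟨f, rfl, rfl⟩ := h.exists_algEquiv hD hx hy hxy
  exact ⟨f, h.map_graded hD f hxm hym⟩

end Lift

section Involution

variable [GradedAlgebra 𝒜] (h : IsPauliGenerators 𝒜 ε X Y)
include h

theorem antiHom_ext [Nontrivial D] (hD : Module.finrank F D = n ^ 2) {ψ ψ' : D →ₗ[F] D}
    (hψ : IsAntiHom ψ) (hψ' : IsAntiHom ψ') (hX : ψ X = ψ' X) (hY : ψ Y = ψ' Y) : ψ = ψ' :=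
  h.linearMap_ext hD fun t => by rw [hψ.map_pauliMonomial, hψ'.map_pauliMonomial, hX, hY]

/-- An anti-homomorphism is a homomorphism to the opposite algebra, where the relation between `x`
and `y` is reversed. -/
theorem exists_antiHom [Nontrivial D] (hD : Module.finrank F D = n ^ 2) {x y : D}
    (hx : x ^ n = 1) (hy : y ^ n = 1) (hxy : y * x = ε • (x * y)) :
    ∃ ψ : D →ₗ[F] D, IsAntiHom ψ ∧ ψ X = x ∧ ψ Y = y := by
  obtain ⟨f, hfX, hfY⟩ := h.exists_algHom hD (x := MulOpposite.op x) (y := MulOpposite.op y)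
    (by rw [← MulOpposite.op_pow, hx, MulOpposite.op_one])
    (by rw [← MulOpposite.op_pow, hy, MulOpposite.op_one])
    (by rw [← MulOpposite.op_mul, ← MulOpposite.op_mul, hxy, MulOpposite.op_smul])
  refine ⟨(MulOpposite.opLinearEquiv F).symm.toLinearMap ∘ₗ f.toLinearMap, ⟨fun a b => ?_, ?_⟩, ?_, ?_⟩
  · simp
  · simp
  · simp [hfX]
  · simp [hfY]

end Involution

end IsPauliGenerators

/-! ### Explicit conjugations of trace-zero matrices -/

section SLConj

variable {n : ℕ}

/-- The columns of `P` are a basis of determinant 1 in which `τ` acts by `θ`. This form of conjugacy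
has no inverses, so it reduces to polynomial identities. -/
theorem slConj_of_basis {τ : Matrix (Fin 2) (Fin 2) (ZMod n)} {θ P : Matrix (Fin 2) (Fin 2) (ZMod n)}
    (hP : P.det = 1) (h : τ * P = P * θ) : SLConj τ θ := by
  let Q : Matrix.SpecialLinearGroup (Fin 2) (ZMod n) := ⟨P, hP⟩
  have hQ := congrArg Subtype.val (inv_mul_cancel Q)
  rw [Matrix.SpecialLinearGroup.coe_mul, Matrix.SpecialLinearGroup.coe_one] at hQ
  refine ⟨Q⁻¹, ?_⟩
  rw [inv_inv, mul_assoc, show τ * Q.1 = Q.1 * θ from h, ← mul_assoc, hQ, one_mul]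

theorem SLConj.exists_basis {τ θ : Matrix (Fin 2) (Fin 2) (ZMod n)} (h : SLConj τ θ) :
    ∃ P : Matrix (Fin 2) (Fin 2) (ZMod n), P.det = 1 ∧ τ * P = P * θ := by
  obtain ⟨Q, hQ⟩ := h
  refine ⟨(Q⁻¹ : Matrix.SpecialLinearGroup (Fin 2) (ZMod n)).1, (Q⁻¹).2, ?_⟩
  rw [← hQ]
  have := congrArg Subtype.val (inv_mul_cancel Q)
  rw [Matrix.SpecialLinearGroup.coe_mul, Matrix.SpecialLinearGroup.coe_one] at this
  rw [← mul_assoc, ← mul_assoc, this, one_mul]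

theorem SLConj.trans {A B C : Matrix (Fin 2) (Fin 2) (ZMod n)} (h : SLConj A B) (h' : SLConj B C) :
    SLConj A C := by
  obtain ⟨P, hP, h1⟩ := h.exists_basis
  obtain ⟨Q, hQ, h2⟩ := h'.exists_basis
  refine slConj_of_basis (P := P * Q) (by rw [Matrix.det_mul, hP, hQ, one_mul]) ?_
  rw [← mul_assoc, h1, mul_assoc, h2, mul_assoc]

/-- Both `det P = 1` and `τ P = P θ` can be checked in each factor, so conjugators modulo `m` and
`k` glue entrywise. -/
theorem SLConj.of_chineseRemainder {m k : ℕ} (hmk : m.Coprime k)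
    {A B : Matrix (Fin 2) (Fin 2) (ZMod (m * k))}
    (h1 : SLConj (A.map (ZMod.castHom (dvd_mul_right m k) (ZMod m)))
      (B.map (ZMod.castHom (dvd_mul_right m k) (ZMod m))))
    (h2 : SLConj (A.map (ZMod.castHom (dvd_mul_left k m) (ZMod k)))
      (B.map (ZMod.castHom (dvd_mul_left k m) (ZMod k)))) : SLConj A B := by
  obtain ⟨P, hP, e1⟩ := h1.exists_basis
  obtain ⟨Q, hQ, e2⟩ := h2.exists_basis
  set e := ZMod.chineseRemainder hmk
  have f1 : (RingHom.fst _ _).comp (e : ZMod (m * k) →+* ZMod m × ZMod k) =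
    ZMod.castHom (dvd_mul_right m k) (ZMod m) := Subsingleton.elim _ _
  have f2 : (RingHom.snd _ _).comp (e : ZMod (m * k) →+* ZMod m × ZMod k) =
    ZMod.castHom (dvd_mul_left k m) (ZMod k) := Subsingleton.elim _ _
  rw [← f1] at e1
  rw [← f2] at e2
  let R : Matrix (Fin 2) (Fin 2) (ZMod (m * k)) := Matrix.of fun i j => e.symm (P i j, Q i j)
  rw [Matrix.det_fin_two] at hP hQ
  refine slConj_of_basis (P := R) ?_ ?_
  · apply e.injective
    rw [Matrix.det_fin_two]
    ext <;> simp [R, hP, hQ]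
  · ext i j
    apply e.injective
    have e1 := congrFun₂ e1 i j
    have e2 := congrFun₂ e2 i j
    simp only [Matrix.mul_apply, Fin.sum_univ_two, Matrix.map_apply, RingHom.comp_apply,
      RingHom.coe_fst, RingHom.coe_snd, RingHom.coe_coe] at e1 e2 ⊢
    ext <;> simp [R, e1, e2]

theorem exists_eq_of_trace_eq_zero {R : Type*} [CommRing R] {τ : Matrix (Fin 2) (Fin 2) R}
    (hd : τ.det = -1) (ht : τ.trace = 0) :
    ∃ x y z : R, τ = !![x, y; z, -x] ∧ x * x + y * z = 1 := by
  refine ⟨τ 0 0, τ 0 1, τ 1 0, ?_, ?_⟩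
  · rw [Matrix.trace_fin_two] at ht
    ext i j
    fin_cases i <;> fin_cases j <;> simp
    linear_combination ht
  · rw [Matrix.trace_fin_two] at ht
    rw [Matrix.det_fin_two] at hd
    linear_combination -hd + τ 0 0 * ht

/-- As `(τ - 1)(τ + 1) = 0`, columns of `τ + 1` and `τ - 1` are eigenvectors for 1 and -1. The
chosen pair has determinant `2(1 ± x)` before `c` normalizes it. -/
theorem slConj_theta1_of_isUnit {x y z : ZMod n} (h : x * x + y * z = 1)
    (h2 : IsUnit (2 : ZMod n)) (hx : IsUnit (1 + x) ∨ IsUnit (1 - x)) :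
    SLConj !![x, y; z, -x] (pauliTheta1 n) := by
  rcases hx with hx | hx <;> obtain ⟨c, hc⟩ := (h2.mul hx).exists_right_inv
  · refine slConj_of_basis (P := !![1 + x, -(c * y); z, c * (1 + x)]) ?_ ?_
    · rw [Matrix.det_fin_two_of]
      linear_combination hc + c * h
    · ext i j
      fin_cases i <;> fin_cases j <;> simp [pauliTheta1]
      · linear_combination h
      · ring
      · ring
      · linear_combination (-c) * h
  · refine slConj_of_basis (P := !![y, -(c * (1 - x)); 1 - x, c * z]) ?_ ?_
    · rw [Matrix.det_fin_two_of]
      linear_combination hc + c * h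
    · ext i j
      fin_cases i <;> fin_cases j <;> simp [pauliTheta1]
      · ring
      · linear_combination c * h
      · linear_combination h
      · ring

/-- A basis `v, τ v` puts `τ` in the form θ₂. For `v = (s, t)`, multiplying the condition `det (v, τ
v) = 1` by `z` turns it into `(z s - x t)² - t² = z`; with `z = 1 + 2 t` it suffices that `z s - x t
= 1 + t`. -/
theorem slConj_theta2_of_isUnit {x y z t : ZMod n} (h : x * x + y * z = 1)
    (hu : IsUnit z) (ht : z = 1 + 2 * t) :
    SLConj !![x, y; z, -x] (pauliTheta2 n) := by
  obtain ⟨c, hc⟩ := hu.exists_right_inv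
  obtain ⟨s, hzs⟩ : ∃ s, z * s = 1 + (x + 1) * t :=
    ⟨c * (1 + (x + 1) * t), by linear_combination (1 + (x + 1) * t) * hc⟩
  refine slConj_of_basis (P := !![s, x * s + y * t; t, z * s - x * t]) ?_ ?_
  · rw [Matrix.det_fin_two_of]
    apply hu.mul_left_cancel
    linear_combination (z * s - x * t + t + 1) * hzs - t ^ 2 * h - ht
  · ext i j
    fin_cases i <;> fin_cases j <;> simp [pauliTheta2]
    · linear_combination s * h
    · ring
    · linear_combination t * h

theorem slConj_theta2_of_isUnit' {x y z t : ZMod n} (h : x * x + y * z = 1)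
    (hu : IsUnit y) (ht : y = 1 + 2 * t) :
    SLConj !![x, y; z, -x] (pauliTheta2 n) := by
  have h1 : SLConj !![x, y; z, -x] !![-x, -z; -y, x] :=
    slConj_of_basis (P := !![0, -1; 1, 0]) (by simp) (by
      ext i j
      fin_cases i <;> fin_cases j <;> simp)
  refine h1.trans ?_
  have h2 := slConj_theta2_of_isUnit (x := -x) (y := -z) (z := -y) (t := - t - 1)
    (by linear_combination h) hu.neg (by linear_combination -ht)
  simpa using h2

/-- Here `E = (τ + 1) / 2` is integral. In the basis `E v, v` with `v = (s, t)` one has `τ v = 2 E v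
- v`, and `E² = E + (w² - w + y z)` gives the first column. The hypothesis on the quadratic form
says that this basis has determinant 1. -/
theorem slConj_of_even {w y z s t : ZMod n}
    (h : z * s ^ 2 - (2 * w - 1) * s * t - y * t ^ 2 = -1) :
    SLConj !![2 * w - 1, 2 * y; 2 * z, -(2 * w - 1)] !![1, 2; 2 * (w ^ 2 - w + y * z), -1] := by
  refine slConj_of_basis (P := !![w * s + y * t, s; z * s + (1 - w) * t, t]) ?_ ?_
  · rw [Matrix.det_fin_two_of]
    linear_combination -h
  · ext i j
    fin_cases i <;> fin_cases j <;> simp <;> ring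

theorem slConj_theta1_of_two : SLConj !![1, 2; 0, -1] (pauliTheta1 n) :=
  slConj_of_basis (P := !![1, -1; 0, 1]) (by simp) (by
    ext i j
    fin_cases i <;> fin_cases j <;> simp [pauliTheta1]
    ring)

end SLConj

/-! ### Conjugacy classes modulo prime powers and modulo n -/

section SLConjClassification

variable {n : ℕ}

theorem SLConj.symm {A B : Matrix (Fin 2) (Fin 2) (ZMod n)} (h : SLConj A B) : SLConj B A := by
  obtain ⟨P, hP⟩ := h
  have e := congrArg Subtype.val (inv_mul_cancel P)
  rw [Matrix.SpecialLinearGroup.coe_mul, Matrix.SpecialLinearGroup.coe_one] at e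
  refine ⟨P⁻¹, ?_⟩
  rw [inv_inv, ← hP]
  simp only [mul_assoc]
  rw [e, mul_one, ← mul_assoc, e, one_mul]

theorem isUnit_or_eq_prime_mul {p k : ℕ} (hp : p.Prime) (u : ZMod (p ^ k)) :
    IsUnit u ∨ ∃ v, u = p * v := by
  have : NeZero (p ^ k) := ⟨pow_ne_zero _ hp.ne_zero⟩
  rw [← ZMod.natCast_zmod_val u, ZMod.isUnit_iff_coprime, Nat.coprime_comm]
  rcases Nat.coprime_or_dvd_of_prime hp u.val with h | h
  · exact Or.inl (h.pow_left k)
  · obtain ⟨v, hv⟩ := h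
    exact Or.inr ⟨v, by rw [hv]; push_cast; rfl⟩

theorem isNilpotent_prime_mul {p k : ℕ} (v : ZMod (p ^ k)) : IsNilpotent ((p : ZMod (p ^ k)) * v) := by
  refine (Commute.all _ _).isNilpotent_mul_right ⟨k, ?_⟩
  rw [← Nat.cast_pow, ZMod.natCast_self]

theorem slConj_theta1_of_odd_primePow {p k : ℕ} (hp : p.Prime) (h2 : p ≠ 2)
    {x y z : ZMod (p ^ k)} (h : x * x + y * z = 1) :
    SLConj !![x, y; z, -x] (pauliTheta1 (p ^ k)) := by
  have hu : IsUnit (2 : ZMod (p ^ k)) := by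
    have := (ZMod.isUnit_iff_coprime 2 (p ^ k)).2
      (Nat.Coprime.pow_right _ ((Nat.coprime_primes Nat.prime_two hp).2 h2.symm))
    exact_mod_cast this
  apply slConj_theta1_of_isUnit h hu
  -- The ring is local and `(1 + x) + (1 - x) = 2` is a unit, so one of the summands is a unit.
  rcases isUnit_or_eq_prime_mul hp (1 + x) with h1 | ⟨v, hv⟩
  · exact Or.inl h1
  · right
    have : 1 - x = 2 - p * v := by rw [← hv]; ring
    rw [this, sub_eq_add_neg]
    exact IsNilpotent.isUnit_add_left_of_commute (isNilpotent_prime_mul v).neg hu (Commute.all _ _)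

@[simp] theorem pauliTheta1_map {m : ℕ} (f : ZMod n →+* ZMod m) :
    (pauliTheta1 n).map f = pauliTheta1 m := by
  ext i j
  fin_cases i <;> fin_cases j <;> simp [pauliTheta1]

@[simp] theorem pauliTheta2_map {m : ℕ} (f : ZMod n →+* ZMod m) :
    (pauliTheta2 n).map f = pauliTheta2 m := by
  ext i j
  fin_cases i <;> fin_cases j <;> simp [pauliTheta2]

theorem matrix_map_involution {m : ℕ} (f : ZMod n →+* ZMod m) (x y z : ZMod n) :
    (!![x, y; z, -x]).map f = !![f x, f y; f z, -f x] := by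
  ext i j
  fin_cases i <;> fin_cases j <;> simp

theorem slConj_theta1_of_odd (hn : Odd n) {x y z : ZMod n} (h : x * x + y * z = 1) :
    SLConj !![x, y; z, -x] (pauliTheta1 n) := by
  induction n using Nat.recOnPosPrimePosCoprime with
  | prime_pow p k hp hk =>
    refine slConj_theta1_of_odd_primePow hp ?_ h
    rintro rfl
    exact Nat.not_even_iff_odd.2 hn ((Nat.even_pow.2 ⟨even_two, hk.ne'⟩))
  | zero => simp at hn
  | one => exact slConj_of_basis (P := 1) (by simp) (Subsingleton.elim _ _)
  | coprime a b ha hb hab iha ihb =>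
    rw [Nat.odd_mul] at hn
    refine SLConj.of_chineseRemainder hab ?_ ?_
    · rw [matrix_map_involution, pauliTheta1_map]
      exact iha hn.1 (by rw [← map_mul, ← map_mul, ← map_add, h, map_one])
    · rw [matrix_map_involution, pauliTheta1_map]
      exact ihb hn.2 (by rw [← map_mul, ← map_mul, ← map_add, h, map_one])

theorem exists_eq_two_mul_or {k : ℕ} (u : ZMod (2 ^ k)) :
    (∃ v, u = 2 * v) ∨ IsUnit u ∧ ∃ v, u = 1 + 2 * v := by
  rcases isUnit_or_eq_prime_mul Nat.prime_two u with h | h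
  · rcases Nat.even_or_odd' u.val with ⟨c, hc | hc⟩
    · left
      refine ⟨c, ?_⟩
      rw [← ZMod.natCast_zmod_val u, hc]
      push_cast
      rfl
    · right
      refine ⟨h, c, ?_⟩
      rw [← ZMod.natCast_zmod_val u, hc]
      push_cast
      ring
  · left
    exact_mod_cast h

theorem isUnit_one_add_two_mul {k : ℕ} (v : ZMod (2 ^ k)) : IsUnit (1 + 2 * v) := by
  have := isNilpotent_prime_mul v
  exact_mod_cast this.isUnit_one_add

/-- A Hensel-type statement: with `s = 2 r` the equation is twice `2 a r² + (1 + 2 b) r = -c`, and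
the left side is injective in `r`, hence surjective on a finite ring. -/
theorem exists_quadratic_root {k : ℕ} (a b c : ZMod (2 ^ k)) :
    ∃ s, a * s ^ 2 + (1 + 2 * b) * s + 2 * c = 0 := by
  have hinj : Function.Injective fun r : ZMod (2 ^ k) => 2 * a * r ^ 2 + (1 + 2 * b) * r := by
    intro r r' hr
    have : (1 + 2 * (a * (r + r') + b)) * (r - r') = 0 := by
      simp only at hr
      linear_combination hr
    exact sub_eq_zero.1 ((isUnit_one_add_two_mul _).mul_right_eq_zero.1 this)
  obtain ⟨r, hr⟩ := (Finite.injective_iff_surjective.1 hinj) (-c)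
  refine ⟨2 * r, ?_⟩
  simp only at hr
  linear_combination 2 * hr

/-- Fixing one variable at 1 leaves a quadratic with odd linear coefficient. The parities of `y` and
`z` decide which variable to fix, and whether the other must be shifted by 1, to make the constant
term even. -/
theorem exists_form_eq_neg_one {k : ℕ} (w y z : ZMod (2 ^ k)) :
    ∃ s t, z * s ^ 2 - (2 * w - 1) * s * t - y * t ^ 2 = -1 := by
  rcases exists_eq_two_mul_or y with ⟨y', rfl⟩ | ⟨-, y', rfl⟩
  · rcases exists_eq_two_mul_or z with ⟨z', rfl⟩ | ⟨-, z', rfl⟩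
    · obtain ⟨s, hs⟩ := exists_quadratic_root (2 * z') (2 * z' - w) (z' - w + 1 - y')
      exact ⟨s + 1, 1, by linear_combination hs⟩
    · obtain ⟨t, ht⟩ := exists_quadratic_root (-(2 * y')) (-w) (1 + z')
      exact ⟨1, t, by linear_combination ht⟩
  · obtain ⟨s, hs⟩ := exists_quadratic_root z (-w) (-y')
    exact ⟨s, 1, by linear_combination hs⟩

theorem eq_zero_or_eq_of_two_mul_eq_zero {k : ℕ} {d : ZMod (2 ^ (k + 1))} (h : 2 * d = 0) :
    d = 0 ∨ d = 2 ^ k := by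
  rw [← ZMod.natCast_zmod_val d] at h
  have h' : ((2 * d.val : ℕ) : ZMod (2 ^ (k + 1))) = 0 := by exact_mod_cast h
  rw [ZMod.natCast_eq_zero_iff] at h'
  replace h' : 2 ^ k ∣ d.val := Nat.dvd_of_mul_dvd_mul_left two_pos (by rwa [← pow_succ'])
  obtain ⟨c, hc⟩ := h'
  have hlt := d.val_lt
  rw [hc, pow_succ] at hlt
  have hc2 : c < 2 := Nat.lt_of_mul_lt_mul_left hlt
  rw [← ZMod.natCast_zmod_val d, hc]
  interval_cases c
  · left; simp
  · right; simp

theorem slConj_two_pow {k : ℕ} {x y z : ZMod (2 ^ (k + 1))} (h : x * x + y * z = 1) :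
    SLConj !![x, y; z, -x] (pauliTheta1 _) ∨ SLConj !![x, y; z, -x] (pauliTheta2 _) ∨
      (1 ≤ k ∧ SLConj !![x, y; z, -x] !![1, 2; 2 ^ k, -1]) := by
  rcases exists_eq_two_mul_or y with ⟨y, rfl⟩ | ⟨hu, t, ht⟩
  swap
  · exact Or.inr (Or.inl (slConj_theta2_of_isUnit' h hu ht))
  rcases exists_eq_two_mul_or z with ⟨z, rfl⟩ | ⟨hu, t, ht⟩
  swap
  · exact Or.inr (Or.inl (slConj_theta2_of_isUnit h hu ht))
  rcases exists_eq_two_mul_or (x + 1) with ⟨w, hw⟩ | ⟨-, w, hw⟩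
  · obtain rfl : x = 2 * w - 1 := by linear_combination hw
    obtain ⟨s, t, hst⟩ := exists_form_eq_neg_one w y z
    have h1 := slConj_of_even hst
    -- The relation `x² + y z = 1` makes twice the lower-left entry vanish, so this entry is 0 or `2
    -- ^ k`.
    have hd : 2 * (2 * (w ^ 2 - w + y * z)) = 0 := by linear_combination h
    rcases eq_zero_or_eq_of_two_mul_eq_zero hd with hd | hd
    · rw [hd] at h1
      exact Or.inl (h1.trans slConj_theta1_of_two)
    -- Modulo 2 the entry is zero anyway, because `2 = 0`.
    · rcases Nat.eq_zero_or_pos k with hk | hk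
      · left
        have h0 : (2 : ZMod (2 ^ (k + 1))) ^ (k + 1) = 0 := by
          exact_mod_cast ZMod.natCast_self (2 ^ (k + 1))
        have hk1 : (2 : ZMod (2 ^ (k + 1))) ^ k = 1 :=
          (congrArg ((2 : ZMod (2 ^ (k + 1))) ^ ·) hk).trans (pow_zero _)
        have e : (2 : ZMod (2 ^ (k + 1))) = 0 := by
          rwa [pow_succ (2 : ZMod (2 ^ (k + 1))) k, hk1, one_mul] at h0
        have h2 := slConj_theta1_of_two (n := 2 ^ (k + 1))
        rw [show (2 : ZMod (2 ^ (k + 1))) * (w ^ 2 - w + y * z) = 0 by rw [e, zero_mul]] at h1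
        exact h1.trans h2
      · rw [hd] at h1
        exact Or.inr (Or.inr ⟨hk, h1⟩)
  -- All of `x, y, z` are even here, which contradicts `x² + y z = 1`.
  · obtain rfl : x = 2 * w := by linear_combination hw
    have h2 : IsUnit (1 + 2 * (-2 * w * w - 2 * y * z) : ZMod (2 ^ (k + 1))) :=
      isUnit_one_add_two_mul _
    have h3 : (1 + 2 * (-2 * w * w - 2 * y * z) : ZMod (2 ^ (k + 1))) = 0 := by
      linear_combination -h
    rw [h3, isUnit_zero_iff] at h2
    have : Fact (1 < 2 ^ (k + 1)) := ⟨Nat.one_lt_two_pow (Nat.succ_ne_zero k)⟩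
    exact absurd h2 zero_ne_one

/-- Modulo the odd part of `n` all three normal forms are conjugate, so the 2-part alone decides the
class. -/
theorem slConj_classification_even [NeZero n] (hn : Even n) {τ : Matrix (Fin 2) (Fin 2) (ZMod n)}
    (hd : τ.det = -1) (ht : τ.trace = 0) :
    SLConj τ (pauliTheta1 n) ∨ SLConj τ (pauliTheta2 n) ∨ (4 ∣ n ∧ SLConj τ (pauliTheta3 n)) := by
  obtain ⟨x, y, z, rfl, h⟩ := exists_eq_of_trace_eq_zero hd ht
  obtain ⟨k, m, hm, rfl⟩ := Nat.exists_eq_two_pow_mul_odd (NeZero.ne n)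
  obtain ⟨k, rfl⟩ : ∃ l, k = l + 1 := by
    refine Nat.exists_eq_succ_of_ne_zero ?_
    rintro rfl
    rw [pow_zero, one_mul] at hn
    exact Nat.not_even_iff_odd.2 hm hn
  have hco : (2 ^ (k + 1)).Coprime m := Nat.Coprime.pow_left _ (Nat.coprime_two_left.2 hm)
  let f := ZMod.castHom (dvd_mul_right (2 ^ (k + 1)) m) (ZMod (2 ^ (k + 1))) 
  let g := ZMod.castHom (dvd_mul_left m (2 ^ (k + 1))) (ZMod m) 
  have h1 : f x * f x + f y * f z = 1 := by rw [← map_mul, ← map_mul, ← map_add, h, map_one]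
  have h2 : g x * g x + g y * g z = 1 := by rw [← map_mul, ← map_mul, ← map_add, h, map_one]
  have hodd := slConj_theta1_of_odd hm h2
  rcases slConj_two_pow h1 with h1 | h1 | ⟨hk, h1⟩
  · left
    refine SLConj.of_chineseRemainder hco ?_ ?_
    · rwa [matrix_map_involution, pauliTheta1_map]
    · rwa [matrix_map_involution, pauliTheta1_map]
  · right; left
    refine SLConj.of_chineseRemainder hco ?_ ?_
    · rwa [matrix_map_involution, pauliTheta2_map]
    · rw [matrix_map_involution, pauliTheta2_map]
      refine hodd.trans (SLConj.symm ?_)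
      have := slConj_theta1_of_odd (n := m) hm (x := 0) (y := 1) (z := 1) (by ring)
      simpa [pauliTheta2] using this
  · right; right
    refine ⟨Dvd.dvd.mul_right (pow_dvd_pow 2 (Nat.succ_le_succ hk)) m, ?_⟩
    have hhalf : 2 ^ (k + 1) * m / 2 = 2 ^ k * m := by
      rw [pow_succ', mul_assoc, Nat.mul_div_cancel_left _ two_pos]
    have e : pauliTheta3 (2 ^ (k + 1) * m) = !![1, 2; 2 ^ k * (m : ZMod (2 ^ (k + 1) * m)), -1] := by
      rw [pauliTheta3, hhalf]
      push_cast
      rfl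
    rw [e]
    refine SLConj.of_chineseRemainder hco ?_ ?_
    · rw [matrix_map_involution]
      convert h1 using 1
      obtain ⟨c, rfl⟩ := hm
      have h0 : (2 : ZMod (2 ^ (k + 1))) ^ (k + 1) = 0 := by
        exact_mod_cast ZMod.natCast_self (2 ^ (k + 1))
      ext i j
      fin_cases i <;> fin_cases j <;> simp [-ZMod.castHom_apply]
      · exact map_ofNat _ 2
      · have e2 : ZMod.castHom (dvd_mul_right (2 ^ (k + 1)) (2 * c + 1)) (ZMod (2 ^ (k + 1))) 2 = 2 :=
          map_ofNat _ 2
        rw [e2]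
        -- For `m = 2 c + 1`, the residue of `2 ^ k * m` modulo `2 ^ (k + 1)` is `2 ^ k`.
        linear_combination (c : ZMod (2 ^ (k + 1))) * h0
    · rw [matrix_map_involution]
      refine hodd.trans (SLConj.symm ?_)
      convert slConj_theta1_of_two (n := m) using 1
      ext i j
      fin_cases i <;> fin_cases j <;> simp [-ZMod.castHom_apply]
      exact map_ofNat _ 2

end SLConjClassification

/-! ### Transport of involutions along automorphisms -/

section Transport

variable {F D G : Type*} [Field F] [Ring D] [Algebra F D] {𝒜 : G → Submodule F D}

/-- Transport of a linear endomorphism along an algebra automorphism. -/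
def AlgEquiv.conjLinear (φ : D ≃ₐ[F] D) (ψ : D →ₗ[F] D) : D →ₗ[F] D :=
  φ.toLinearMap ∘ₗ ψ ∘ₗ φ.symm.toLinearMap

@[simp] theorem AlgEquiv.conjLinear_apply (φ : D ≃ₐ[F] D) (ψ : D →ₗ[F] D) (x : D) :
    φ.conjLinear ψ x = φ (ψ (φ.symm x)) := rfl

theorem AlgEquiv.map_symm_graded {φ : D ≃ₐ[F] D} {μ : G ≃ G}
    (hφ : ∀ t, (𝒜 t).map φ.toLinearMap = 𝒜 (μ t)) (t : G) :
    (𝒜 t).map φ.symm.toLinearMap = 𝒜 (μ.symm t) := by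
  have h := hφ (μ.symm t)
  rw [μ.apply_symm_apply] at h
  rw [← h]
  ext x
  simp

theorem IsTauInvolution.conj (hs : gradingSupport 𝒜 = Set.univ) {φ : D ≃ₐ[F] D} {μ : G ≃ G}
    (hφ : ∀ t, (𝒜 t).map φ.toLinearMap = 𝒜 (μ t)) {τ τ' : G → G}
    (hτ : ∀ t, τ' (μ t) = μ (τ t)) {ψ : D →ₗ[F] D} (h : IsTauInvolution 𝒜 τ ψ) :
    IsTauInvolution 𝒜 τ' (φ.conjLinear ψ) := by
  refine ⟨⟨fun x y => by simp [h.1.map_mul], fun x => by simp [h.1.involutive]⟩, fun t _ => ?_⟩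
  obtain ⟨t, rfl⟩ := μ.surjective t
  rw [AlgEquiv.conjLinear, Submodule.map_comp, Submodule.map_comp, AlgEquiv.map_symm_graded hφ,
    μ.symm_apply_apply, h.2 t (by simp [hs]), hφ, hτ]

theorem InvolutionsIsomorphic.conj (hs : gradingSupport 𝒜 = Set.univ) {φ : D ≃ₐ[F] D} {μ : G ≃ G}
    (hφ : ∀ t, (𝒜 t).map φ.toLinearMap = 𝒜 (μ t)) {ψ ψ' : D →ₗ[F] D}
    (h : InvolutionsIsomorphic 𝒜 ψ ψ') :
    InvolutionsIsomorphic 𝒜 (φ.conjLinear ψ) (φ.conjLinear ψ') := by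
  obtain ⟨χ, hχ, e⟩ := h
  refine ⟨(φ.symm.trans χ).trans φ, fun t _ => ?_, fun x => by simp [e]⟩
  have h1 : ((φ.symm.trans χ).trans φ).toLinearMap =
    φ.toLinearMap ∘ₗ χ.toLinearMap ∘ₗ φ.symm.toLinearMap := rfl
  rw [h1, Submodule.map_comp, Submodule.map_comp, AlgEquiv.map_symm_graded hφ,
    hχ _ (by simp [hs]), hφ, μ.apply_symm_apply]

/-- Conjugation by `φ` is a bijection between the two sets of involutions; applied to `φ` and to its
inverse, `InvolutionsIsomorphic.conj` shows that it respects isomorphism both ways. -/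
theorem numIsoClasses_congr (hs : gradingSupport 𝒜 = Set.univ) {φ : D ≃ₐ[F] D} {μ : G ≃ G}
    (hφ : ∀ t, (𝒜 t).map φ.toLinearMap = 𝒜 (μ t)) {τ τ' : G → G}
    (hτ : ∀ t, τ' (μ t) = μ (τ t)) : numIsoClasses 𝒜 τ = numIsoClasses 𝒜 τ' := by
  have hφ' := AlgEquiv.map_symm_graded hφ
  have hτ' (t : G) : τ (μ.symm t) = μ.symm (τ' t) := by
    rw [Equiv.eq_symm_apply, ← hτ, μ.apply_symm_apply]
  have e1 (ψ : D →ₗ[F] D) : φ.symm.conjLinear (φ.conjLinear ψ) = ψ := by ext x; simp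
  have e2 (ψ : D →ₗ[F] D) : φ.conjLinear (φ.symm.conjLinear ψ) = ψ := by ext x; simp
  let e : {ψ : D →ₗ[F] D // IsTauInvolution 𝒜 τ ψ} ≃ {ψ : D →ₗ[F] D // IsTauInvolution 𝒜 τ' ψ} :=
    { toFun := fun ψ => ⟨φ.conjLinear ψ.1, ψ.2.conj hs hφ hτ⟩
      invFun := fun ψ => ⟨φ.symm.conjLinear ψ.1, ψ.2.conj hs hφ' hτ'⟩
      left_inv := fun ψ => Subtype.ext (e1 ψ.1)
      right_inv := fun ψ => Subtype.ext (e2 ψ.1) }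
  refine Nat.card_congr (Quotient.congr e fun ψ ψ' => ⟨fun h => h.conj hs hφ, fun h => ?_⟩)
  have := InvolutionsIsomorphic.conj hs hφ' h
  simp only [e, Equiv.coe_fn_mk, e1] at this
  exact this

theorem equivalent_of_map (hs : gradingSupport 𝒜 = Set.univ) {φ : D ≃ₐ[F] D} {μ : G ≃ G}
    (hφ : ∀ t, (𝒜 t).map φ.toLinearMap = 𝒜 (μ t)) {ψ ψ' : D →ₗ[F] D}
    (h : ∀ x, φ (ψ x) = ψ' (φ x)) : InvolutionsEquivalent 𝒜 ψ ψ' :=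
  ⟨φ, ⟨μ.subtypeEquiv fun t => by simp [hs], fun t => by simp [hφ]⟩, h⟩

theorem equivalent_conj (hs : gradingSupport 𝒜 = Set.univ) {φ : D ≃ₐ[F] D} {μ : G ≃ G}
    (hφ : ∀ t, (𝒜 t).map φ.toLinearMap = 𝒜 (μ t)) (ψ : D →ₗ[F] D) :
    InvolutionsEquivalent 𝒜 ψ (φ.conjLinear ψ) :=
  equivalent_of_map hs hφ fun x => by simp

theorem InvolutionsEquivalent.trans {ψ₁ ψ₂ ψ₃ : D →ₗ[F] D} (h : InvolutionsEquivalent 𝒜 ψ₁ ψ₂)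
    (h' : InvolutionsEquivalent 𝒜 ψ₂ ψ₃) : InvolutionsEquivalent 𝒜 ψ₁ ψ₃ := by
  obtain ⟨φ, ⟨α, hα⟩, e⟩ := h
  obtain ⟨φ', ⟨α', hα'⟩, e'⟩ := h'
  refine ⟨φ.trans φ', ⟨α.trans α', fun g => ?_⟩, fun x => by simp [e, e']⟩
  rw [Equiv.trans_apply, ← hα', ← hα]
  ext x
  simp

theorem InvolutionsEquivalent.symm {ψ ψ' : D →ₗ[F] D} (h : InvolutionsEquivalent 𝒜 ψ ψ') :
    InvolutionsEquivalent 𝒜 ψ' ψ := by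
  obtain ⟨φ, ⟨α, hα⟩, e⟩ := h
  refine ⟨φ.symm, ⟨α.symm, fun g => ?_⟩, fun x => ?_⟩
  · obtain ⟨g, rfl⟩ := α.surjective g
    rw [← hα, α.symm_apply_apply]
    ext x
    simp
  · apply φ.injective
    simp [e]

theorem InvolutionsIsomorphic.equivalent {ψ ψ' : D →ₗ[F] D}
    (h : InvolutionsIsomorphic 𝒜 ψ ψ') : InvolutionsEquivalent 𝒜 ψ ψ' := by
  obtain ⟨φ, hφ, e⟩ := h
  exact ⟨φ, ⟨Equiv.refl _, fun g => hφ g g.2⟩, e⟩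

end Transport

/-- The permutation of `ℤₙ²` given by a matrix of determinant `1`. -/
def mulVecEquiv {n : ℕ} (P : Matrix (Fin 2) (Fin 2) (ZMod n)) (hP : P.det = 1) :
    PauliGroup n ≃ PauliGroup n where
  toFun := P.mulVec
  invFun := P.adjugate.mulVec
  left_inv t := by rw [Matrix.mulVec_mulVec, Matrix.adjugate_mul, hP, one_smul, Matrix.one_mulVec]
  right_inv t := by rw [Matrix.mulVec_mulVec, Matrix.mul_adjugate, hP, one_smul, Matrix.one_mulVec]

/-- The images of the generators are taken in the order in which an anti-automorphism multiplies
them; this is the source of the sign. -/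
theorem pauliForm_mulVec {n : ℕ} (M : Matrix (Fin 2) (Fin 2) (ZMod n)) :
    pauliForm (M.mulVec (pauliB n)) (M.mulVec (pauliA n)) = -M.det := by
  rw [Matrix.det_fin_two]
  simp [pauliForm, pauliA, pauliB, Matrix.mulVec, dotProduct]
  ring

/-! ### Dependence on the conjugacy class; the matrix of an involution -/

namespace IsPauliGenerators

variable {F D : Type*} [Field F] [Ring D] [Algebra F D] {n : ℕ} [NeZero n]
  {𝒜 : PauliGroup n → Submodule F D} [GradedAlgebra 𝒜] {ε : F} {X Y : D}
  (h : IsPauliGenerators 𝒜 ε X Y)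
include h

section Conjugacy

variable [IsAlgClosed F] [IsSimpleRing D] (hD : Module.finrank F D = n ^ 2)
  {τ θ : Matrix (Fin 2) (Fin 2) (ZMod n)} (hτ : SLConj τ θ)
include hD hτ

theorem numIsoClasses_eq_of_slConj : numIsoClasses 𝒜 τ.mulVec = numIsoClasses 𝒜 θ.mulVec := by
  obtain ⟨P, hP, e⟩ := hτ.exists_basis
  obtain ⟨φ, hφ⟩ := h.exists_algEquiv_map hD hP
  refine (numIsoClasses_congr (μ := mulVecEquiv P hP) h.support_eq hφ fun t => ?_).symm
  change τ.mulVec (P.mulVec t) = P.mulVec (θ.mulVec t)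
  rw [Matrix.mulVec_mulVec, Matrix.mulVec_mulVec, e]

theorem exists_equivalent_of_slConj {ψ : D →ₗ[F] D} (hψ : IsTauInvolution 𝒜 τ.mulVec ψ) :
    ∃ ψ', IsTauInvolution 𝒜 θ.mulVec ψ' ∧ InvolutionsEquivalent 𝒜 ψ ψ' := by
  obtain ⟨P, hP, e⟩ := hτ.symm.exists_basis
  obtain ⟨φ, hφ⟩ := h.exists_algEquiv_map hD hP
  refine ⟨φ.conjLinear ψ, hψ.conj (μ := mulVecEquiv P hP) h.support_eq hφ fun t => ?_,
    equivalent_conj (μ := mulVecEquiv P hP) h.support_eq hφ ψ⟩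
  change θ.mulVec (P.mulVec t) = P.mulVec (τ.mulVec t)
  rw [Matrix.mulVec_mulVec, Matrix.mulVec_mulVec, e]

end Conjugacy

section TauMatrix

omit [GradedAlgebra 𝒜] in
theorem pow_val_injective {a b : ZMod n} (hab : ε ^ a.val = ε ^ b.val) : a = b :=
  ZMod.val_injective n (h.primitive.pow_inj a.val_lt b.val_lt hab)

omit [NeZero n] [GradedAlgebra 𝒜] in
theorem pow_val_one : ε ^ (1 : ZMod n).val = ε := by
  have := pow_val_natCast h.primitive.pow_eq_one 1
  rwa [Nat.cast_one, pow_one] at this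

/-- Degrees of images of monomials make `τ` linear, the image of the commutation relation fixes the
determinant, and `ψ² = 1` gives `M² = 1`. -/
theorem exists_matrix_of_isTauInvolution [Nontrivial D] (hD : Module.finrank F D = n ^ 2)
    {τ : PauliGroup n → PauliGroup n} {ψ : D →ₗ[F] D} (hψ : IsTauInvolution 𝒜 τ ψ) :
    ∃ M : Matrix (Fin 2) (Fin 2) (ZMod n), τ = M.mulVec ∧ M.det = -1 ∧ M.trace = 0 := by
  have hmem {t : PauliGroup n} {x : D} (hx : x ∈ 𝒜 t) : ψ x ∈ 𝒜 (τ t) := by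
    rw [← hψ.2 t (by simp [h.support_eq])]
    exact Submodule.mem_map_of_mem hx
  have hne {x : D} (hx : x ≠ 0) : ψ x ≠ 0 := (map_ne_zero_iff ψ hψ.1.injective).2 hx
  let M : Matrix (Fin 2) (Fin 2) (ZMod n) :=
    Matrix.of fun i j => if j = 0 then τ (pauliA n) i else τ (pauliB n) i
  have hMa : M.mulVec (pauliA n) = τ (pauliA n) := by
    funext i; simp [M, pauliA, Matrix.mulVec, dotProduct]
  have hMb : M.mulVec (pauliB n) = τ (pauliB n) := by
    funext i; simp [M, pauliB, Matrix.mulVec, dotProduct]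
  have hM : τ = M.mulVec := by
    funext t
    have h1 := SetLike.mul_mem_graded (SetLike.pow_mem_graded (t 1).val (hmem h.mem_b))
      (SetLike.pow_mem_graded (t 0).val (hmem h.mem_a))
    rw [← hψ.1.isAntiHom.map_pauliMonomial] at h1
    rw [eq_of_mem_graded (hmem (h.monomial_mem t)) h1 (hne (h.isUnit_monomial t).ne_zero),
      ← hMa, ← hMb]
    funext i
    simp only [Matrix.mulVec, dotProduct, Fin.sum_univ_two, Pi.add_apply, Pi.smul_apply, pauliA,
      pauliB]
    simp only [nsmul_eq_mul, ZMod.natCast_zmod_val, Matrix.cons_val_zero, Matrix.cons_val_one]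
    ring
  have hdet : M.det = -1 := by
    have h1 := h.mul_comm_of_mem hD (hmem h.mem_b) (hmem h.mem_a)
    have h2 := congrArg ψ h.comm
    rw [hψ.1.map_mul, map_smul, hψ.1.map_mul, h1, ← hMa, ← hMb, pauliForm_mulVec] at h2
    have h3 : ψ X * ψ Y ≠ 0 := by
      rw [← hψ.1.map_mul]
      refine hne (IsUnit.ne_zero (IsUnit.mul ?_ ?_))
      · exact IsUnit.of_pow_eq_one h.pow_b (NeZero.ne n)
      · exact IsUnit.of_pow_eq_one h.pow_a (NeZero.ne n)
    have h4 := smul_left_injective F h3 h2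
    have h5 : -M.det = 1 := h.pow_val_injective (h4.trans h.pow_val_one.symm)
    rw [← h5, neg_neg]
  refine ⟨M, hM, hdet, ?_⟩
  have hsq : M * M = 1 := by
    have h1 (t : PauliGroup n) : M.mulVec (M.mulVec t) = t := by
      have := hmem (hmem (h.monomial_mem t))
      rw [hψ.1.involutive] at this
      rw [← hM]
      exact (eq_of_mem_graded (h.monomial_mem t) this (h.isUnit_monomial t).ne_zero).symm
    apply Matrix.ext_of_mulVec_single
    intro i
    rw [← Matrix.mulVec_mulVec, h1, Matrix.one_mulVec]
  have e00 := congrFun₂ hsq 0 0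
  have e01 := congrFun₂ hsq 0 1
  simp only [Matrix.mul_apply, Fin.sum_univ_two, Matrix.one_apply] at e00 e01
  rw [Matrix.det_fin_two] at hdet
  rw [Matrix.trace_fin_two]
  simp only [if_true, zero_ne_one, if_false] at e00 e01
  -- By Cayley–Hamilton `tr M • M = M² + det M = 0`. Its top row is `e00 + hdet` and `e01`, and
  -- `e00` says that the top row pairs to 1 with the first column.
  linear_combination -(M 0 0 + M 1 1) * e00 + M 0 0 * (e00 + hdet) + M 1 0 * e01

end TauMatrix

end IsPauliGenerators

/-! ### Square roots among the n-th roots of unity -/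

section RootsOfUnity

variable {F : Type*} [Field F] {n : ℕ} {ε : F}

theorem IsPrimitiveRoot.pow_half_eq_neg_one {m : ℕ} (hε : IsPrimitiveRoot ε n) (hn : n ≠ 0)
    (hm : n = 2 * m) : ε ^ m = -1 := by
  have h1 : ε ^ m ≠ 1 := hε.pow_ne_one_of_pos_of_lt (by omega) (by omega)
  have h2 : ε ^ m * ε ^ m = 1 := by rw [← pow_add, ← two_mul, ← hm, hε.pow_eq_one]
  exact (mul_self_eq_one_iff.1 h2).resolve_left h1

/-- Writing `c = ε ^ i`, the condition `c ^ m = 1` forces `i` to be even. -/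
theorem IsPrimitiveRoot.exists_sq_of_pow_half {m : ℕ} (hε : IsPrimitiveRoot ε n) (hn : n ≠ 0)
    (hm : n = 2 * m) {c : F} (hc : c ^ m = 1) : ∃ κ : F, κ ^ n = 1 ∧ κ ^ 2 = c := by
  have : NeZero n := ⟨hn⟩
  obtain ⟨i, -, rfl⟩ := hε.eq_pow_of_pow_eq_one (ξ := c)
    (by rw [hm, mul_comm, pow_mul, hc, one_pow])
  rw [← pow_mul, hε.pow_eq_one_iff_dvd, hm] at hc
  obtain ⟨j, rfl⟩ : 2 ∣ i := Nat.dvd_of_mul_dvd_mul_right (by omega : 0 < m) hc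
  exact ⟨ε ^ j, by rw [← pow_mul, mul_comm, pow_mul, hε.pow_eq_one, one_pow],
    by rw [← pow_mul, mul_comm]⟩

theorem exists_sq_of_odd (hn : Odd n) {c : F} (hc : c ^ n = 1) : ∃ κ : F, κ ^ n = 1 ∧ κ ^ 2 = c := by
  obtain ⟨k, rfl⟩ := hn
  refine ⟨c ^ (k + 1), by rw [← pow_mul, mul_comm, pow_mul, hc, one_pow], ?_⟩
  rw [← pow_mul, show (k + 1) * 2 = (2 * k + 1) + 1 by ring, pow_succ, hc, one_mul]

end RootsOfUnity

namespace IsPauliForm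

variable {F D : Type*} [Field F] [Ring D] [Algebra F D] {n : ℕ}
  {𝒜 : PauliGroup n → Submodule F D} {X Y : D} {θ : Matrix (Fin 2) (Fin 2) (ZMod n)}
  {la lb : F} {ψ : D →ₗ[F] D}

theorem isAntiHom (hψ : IsPauliForm 𝒜 X Y θ la lb ψ) : IsAntiHom ψ :=
  hψ.isTauInvolution.1.isAntiHom

theorem involutive (hψ : IsPauliForm 𝒜 X Y θ la lb ψ) (x : D) : ψ (ψ x) = x :=
  hψ.isTauInvolution.1.involutive x

end IsPauliForm

/-! ### Existence and isomorphism of the triples -/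

namespace IsPauliGenerators

variable {F D : Type*} [Field F] [Ring D] [Algebra F D] {n : ℕ} [NeZero n]
  {𝒜 : PauliGroup n → Submodule F D} [GradedAlgebra 𝒜] {ε : F} {X Y : D}
  {θ : Matrix (Fin 2) (Fin 2) (ZMod n)} {la lb la' lb' : F} {ψ ψ' : D →ₗ[F] D}
  (h : IsPauliGenerators 𝒜 ε X Y)
include h

theorem exists_isPauliForm [Nontrivial D] (hD : Module.finrank F D = n ^ 2)
    (hψ : IsTauInvolution 𝒜 θ.mulVec ψ) : ∃ la lb, IsPauliForm 𝒜 X Y θ la lb ψ := by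
  have key {t : PauliGroup n} {x : D} (hx : x ∈ 𝒜 t) :
      ∃ c : F, ψ x = c • pauliMonomial X Y (θ.mulVec t) := by
    refine mem_graded_smul hD h.support_eq (h.monomial_mem _) (h.isUnit_monomial _).ne_zero ?_
    rw [← hψ.2 t (by simp [h.support_eq])]
    exact Submodule.mem_map_of_mem hx
  obtain ⟨la, ha⟩ := key h.mem_a
  obtain ⟨lb, hb⟩ := key h.mem_b
  exact ⟨la, lb, hψ, ha, hb⟩

omit [GradedAlgebra 𝒜] in
theorem isPauliForm_coeff_unique [Nontrivial D] (hψ : IsPauliForm 𝒜 X Y θ la lb ψ)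
    (hψ' : IsPauliForm 𝒜 X Y θ la' lb' ψ) : la = la' ∧ lb = lb' :=
  ⟨smul_left_injective F (h.isUnit_monomial _).ne_zero (hψ.map_a.symm.trans hψ'.map_a),
    smul_left_injective F (h.isUnit_monomial _).ne_zero (hψ.map_b.symm.trans hψ'.map_b)⟩

/-- Determinant -1 makes the commutation relation of the images automatic, leaving only their n-th
powers to check. As `ψ ∘ ψ` is multiplicative, being an involution need only be tested on the
generators. -/
theorem existsUnique_isPauliForm [Nontrivial D] (hD : Module.finrank F D = n ^ 2)
    (hdet : θ.det = -1)
    (hU : (la • pauliMonomial X Y (θ.mulVec (pauliA n))) ^ n = 1)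
    (hV : (lb • pauliMonomial X Y (θ.mulVec (pauliB n))) ^ n = 1)
    (hinv : ∀ ψ : D →ₗ[F] D, IsAntiHom ψ →
      ψ X = la • pauliMonomial X Y (θ.mulVec (pauliA n)) →
      ψ Y = lb • pauliMonomial X Y (θ.mulVec (pauliB n)) → ψ (ψ X) = X ∧ ψ (ψ Y) = Y) :
    ∃! ψ, IsPauliForm 𝒜 X Y θ la lb ψ := by
  set U := la • pauliMonomial X Y (θ.mulVec (pauliA n))
  set V := lb • pauliMonomial X Y (θ.mulVec (pauliB n))
  have hUm : U ∈ 𝒜 (θ.mulVec (pauliA n)) := Submodule.smul_mem _ _ (h.monomial_mem _)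
  have hVm : V ∈ 𝒜 (θ.mulVec (pauliB n)) := Submodule.smul_mem _ _ (h.monomial_mem _)
  have hVU := h.mul_comm_of_mem hD hVm hUm
  rw [pauliForm_mulVec, hdet, neg_neg, h.pow_val_one] at hVU
  obtain ⟨ψ, hψ, hX, hY⟩ := h.exists_antiHom hD hU hV hVU
  obtain ⟨hXX, hYY⟩ := hinv ψ hψ hX hY
  have hid : ψ ∘ₗ ψ = LinearMap.id := by
    apply h.linearMap_ext hD
    intro t
    simp only [LinearMap.comp_apply, hψ.map_pauliMonomial, hψ.map_mul, hψ.map_pow, hXX, hYY]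
    rfl
  have hinvol : IsAlgInvolution ψ := ⟨hψ.map_mul, LinearMap.congr_fun hid⟩
  refine ⟨ψ, ⟨⟨hinvol, fun t _ => ?_⟩, hX, hY⟩, fun ψ' hψ' => ?_⟩
  · refine h.map_graded_of_linearMap hD (fun t => ?_)
      (fun t => (map_ne_zero_iff ψ hinvol.injective).2 (h.isUnit_monomial t).ne_zero) t
    rw [hψ.map_pauliMonomial, hX, hY]
    convert SetLike.mul_mem_graded (SetLike.pow_mem_graded (t 1).val hVm)
      (SetLike.pow_mem_graded (t 0).val hUm) using 2
    funext i
    simp only [Matrix.mulVec, dotProduct, Fin.sum_univ_two, Pi.add_apply, Pi.smul_apply, pauliA,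
      pauliB]
    simp only [nsmul_eq_mul, ZMod.natCast_zmod_val, Matrix.cons_val_zero, Matrix.cons_val_one]
    ring
  · exact h.antiHom_ext hD hψ'.isAntiHom hψ (hψ'.map_a.trans hX.symm) (hψ'.map_b.trans hY.symm)

theorem intertwines_of_generators [Nontrivial D] (hD : Module.finrank F D = n ^ 2)
    (hψ : IsAntiHom ψ) (hψ' : IsAntiHom ψ') (φ : D ≃ₐ[F] D) (hX : φ (ψ X) = ψ' (φ X))
    (hY : φ (ψ Y) = ψ' (φ Y)) (x : D) : φ (ψ x) = ψ' (φ x) := by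
  have : φ.toLinearMap ∘ₗ ψ = ψ' ∘ₗ φ.toLinearMap := by
    apply h.linearMap_ext hD
    intro t
    simp only [LinearMap.comp_apply, AlgEquiv.toLinearMap_apply, hψ.map_pauliMonomial, map_mul,
      map_pow, hX, hY]
    simp only [pauliMonomial, map_mul, map_pow, hψ'.map_mul, hψ'.map_pow]
  exact LinearMap.congr_fun this x

/-- Graded automorphisms are exactly the rescalings of `X` and `Y` by n-th roots of unity. The two
equations express intertwining on `X` and on `Y`. -/
theorem isomorphic_iff [IsSimpleRing D] (hD : Module.finrank F D = n ^ 2)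
    (hψ : IsPauliForm 𝒜 X Y θ la lb ψ) (hψ' : IsPauliForm 𝒜 X Y θ la' lb' ψ') :
    InvolutionsIsomorphic 𝒜 ψ ψ' ↔ ∃ κ μ : F, κ ^ n = 1 ∧ μ ^ n = 1 ∧
      la * (κ ^ (θ 0 0).val * μ ^ (θ 1 0).val) = κ * la' ∧
      lb * (κ ^ (θ 0 1).val * μ ^ (θ 1 1).val) = μ * lb' := by
  have hA : θ.mulVec (pauliA n) = ![θ 0 0, θ 1 0] := by
    funext i; fin_cases i <;> simp [pauliA, Matrix.mulVec, dotProduct]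
  have hB : θ.mulVec (pauliB n) = ![θ 0 1, θ 1 1] := by
    funext i; fin_cases i <;> simp [pauliB, Matrix.mulVec, dotProduct]
  have hmon (φ : D ≃ₐ[F] D) {κ μ : F} (h1 : φ X = κ • X) (h2 : φ Y = μ • Y) (t : PauliGroup n) :
      φ (pauliMonomial X Y t) = (κ ^ (t 0).val * μ ^ (t 1).val) • pauliMonomial X Y t := by
    simp only [pauliMonomial, map_mul, map_pow, h1, h2, smul_pow, smul_mul_smul_comm]
  have hXY (φ : D ≃ₐ[F] D) {κ μ : F} (h1 : φ X = κ • X) (h2 : φ Y = μ • Y) :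
      (φ (ψ X) = ψ' (φ X) ↔ la * (κ ^ (θ 0 0).val * μ ^ (θ 1 0).val) = κ * la') ∧
      (φ (ψ Y) = ψ' (φ Y) ↔ lb * (κ ^ (θ 0 1).val * μ ^ (θ 1 1).val) = μ * lb') := by
    constructor
    · rw [h1, map_smul, hψ.map_a, hψ'.map_a, map_smul, hmon φ h1 h2, smul_smul, smul_smul,
        (smul_left_injective F (h.isUnit_monomial _).ne_zero).eq_iff, hA]
      rfl
    · rw [h2, map_smul, hψ.map_b, hψ'.map_b, map_smul, hmon φ h1 h2, smul_smul, smul_smul,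
        (smul_left_injective F (h.isUnit_monomial _).ne_zero).eq_iff, hB]
      rfl
  constructor
  · rintro ⟨φ, hφ, e⟩
    have key {t : PauliGroup n} {x : D} (hx : x ∈ 𝒜 t) (hxn : x ^ n = 1) :
        ∃ c : F, c ^ n = 1 ∧ φ x = c • x := by
      have hx0 : x ≠ 0 := (IsUnit.of_pow_eq_one hxn (NeZero.ne n)).ne_zero
      obtain ⟨c, hc⟩ : ∃ c : F, φ x = c • x := by
        refine mem_graded_smul hD h.support_eq hx hx0 ?_
        rw [← hφ t (by simp [h.support_eq])]
        exact Submodule.mem_map_of_mem (f := φ.toLinearMap) hx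
      refine ⟨c, ?_, hc⟩
      have h1 := congrArg φ hxn
      rw [map_pow, hc, smul_pow, hxn, map_one] at h1
      exact smul_left_injective F (one_ne_zero (α := D)) (h1.trans (one_smul F (1 : D)).symm)
    obtain ⟨κ, hκ, h1⟩ := key h.mem_a h.pow_a
    obtain ⟨μ, hμ, h2⟩ := key h.mem_b h.pow_b
    exact ⟨κ, μ, hκ, hμ, (hXY φ h1 h2).1.1 (e X), (hXY φ h1 h2).2.1 (e Y)⟩
  · rintro ⟨κ, μ, hκ, hμ, e1, e2⟩
    obtain ⟨φ, h1, h2⟩ := h.exists_algEquiv hD (smul_pow_eq_one hκ h.pow_a)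
      (smul_pow_eq_one hμ h.pow_b)
      (by rw [smul_mul_smul_comm, smul_mul_smul_comm, h.comm, smul_comm, mul_comm κ])
    refine ⟨φ, fun t _ => ?_, h.intertwines_of_generators hD hψ.isAntiHom hψ'.isAntiHom φ
      ((hXY φ h1 h2).1.2 e1) ((hXY φ h1 h2).2.2 e2)⟩
    have := h.map_graded hD φ (M := 1)
      (by rw [h1, Matrix.one_mulVec]; exact Submodule.smul_mem _ _ h.mem_a)
      (by rw [h2, Matrix.one_mulVec]; exact Submodule.smul_mem _ _ h.mem_b) t
    rwa [Matrix.one_mulVec] at this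

theorem equivalent_of_generators [IsSimpleRing D] (hD : Module.finrank F D = n ^ 2)
    {M : Matrix (Fin 2) (Fin 2) (ZMod n)} (hM : M.det = 1) {φ : D ≃ₐ[F] D}
    (hφX : φ X ∈ 𝒜 (M.mulVec (pauliA n))) (hφY : φ Y ∈ 𝒜 (M.mulVec (pauliB n)))
    (hψ : IsAntiHom ψ) (hψ' : IsAntiHom ψ') (hX : φ (ψ X) = ψ' (φ X))
    (hY : φ (ψ Y) = ψ' (φ Y)) : InvolutionsEquivalent 𝒜 ψ ψ' :=
  equivalent_of_map (μ := mulVecEquiv M hM) h.support_eq (h.map_graded hD φ hφX hφY)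
    (h.intertwines_of_generators hD hψ hψ' φ hX hY)

end IsPauliGenerators

theorem numIsoClasses_eq_one {F D G : Type*} [Field F] [Ring D] [Algebra F D]
    {𝒜 : G → Submodule F D} {τ : G → G} (hex : ∃ ψ, IsTauInvolution 𝒜 τ ψ)
    (hiso : ∀ ψ ψ', IsTauInvolution 𝒜 τ ψ → IsTauInvolution 𝒜 τ ψ' →
      InvolutionsIsomorphic 𝒜 ψ ψ') : numIsoClasses 𝒜 τ = 1 := by
  obtain ⟨ψ, hψ⟩ := hex
  rw [numIsoClasses, Nat.card_eq_one_iff_exists]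
  refine ⟨Quotient.mk _ ⟨ψ, hψ⟩, fun q => ?_⟩
  induction q using Quotient.inductionOn with
  | h ψ' => exact Quotient.sound (hiso _ _ ψ'.2 hψ)

theorem IsAntiHom.coeff_pow_eq_one {F D : Type*} [Field F] [Ring D] [Algebra F D] [Nontrivial D]
    {n : ℕ} {ψ : D →ₗ[F] D} (hψ : IsAntiHom ψ) {c : F} {x y : D} (hx : x ^ n = 1) (hy : y ^ n = 1)
    (e : ψ x = c • y) : c ^ n = 1 := by
  have h1 := congrArg ψ hx
  rw [hψ.map_pow, e, smul_pow, hy, hψ.map_one] at h1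
  exact smul_left_injective F (one_ne_zero (α := D)) (h1.trans (one_smul F (1 : D)).symm)

/-! ### The power of Y inverse to Y, and the images under θ₁, θ₂, θ₃ -/

namespace IsPauliGenerators

variable {F D : Type*} [Field F] [Ring D] [Algebra F D] {n : ℕ} [NeZero n]
  {𝒜 : PauliGroup n → Submodule F D} {ε : F} {X Y : D}
  {la lb la' lb' : F} {ψ ψ' : D →ₗ[F] D}
  (h : IsPauliGenerators 𝒜 ε X Y)
include h

section Inverse

theorem pow_neg_one_mul : Y ^ (-1 : ZMod n).val * Y = 1 := by
  have h1 := pow_val_add h.pow_b (-1) 1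
  have h2 := pow_val_natCast h.pow_b 1
  rw [Nat.cast_one, pow_one] at h2
  rw [h2, neg_add_cancel, ZMod.val_zero, pow_zero] at h1
  exact h1.symm

theorem mul_pow_neg_one : Y * Y ^ (-1 : ZMod n).val = 1 := by
  rw [← pow_succ', pow_succ, h.pow_neg_one_mul]

omit [NeZero n] in
theorem pow_neg_one_pow : (Y ^ (-1 : ZMod n).val) ^ n = 1 := by
  rw [← pow_mul, mul_comm, pow_mul, h.pow_b, one_pow]

theorem antiHom_pow_neg_one_mul (hψ : IsAntiHom ψ) : ψ (Y ^ (-1 : ZMod n).val) * ψ Y = 1 := by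
  rw [← hψ.map_mul, h.mul_pow_neg_one, hψ.map_one]

theorem pow_neg_one_pow_half {m : ℕ} (hm : n = 2 * m) : (Y ^ (-1 : ZMod n).val) ^ m = Y ^ m := by
  have h1 : (Y ^ (-1 : ZMod n).val) ^ m * Y ^ m = 1 := by
    rw [← (Commute.pow_left (Commute.refl Y) _).mul_pow, h.pow_neg_one_mul, one_pow]
  have h2 : Y ^ m * Y ^ m = 1 := by rw [← pow_add, ← two_mul, ← hm, h.pow_b]
  calc _ = (Y ^ (-1 : ZMod n).val) ^ m * (Y ^ m * Y ^ m) := by rw [h2, mul_one]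
    _ = _ := by rw [← mul_assoc, h1, one_mul]

end Inverse

section ThetaMonomials

omit [NeZero n] in
theorem monomial_theta1_a : pauliMonomial X Y ((pauliTheta1 n).mulVec (pauliA n)) = X := by
  have e : (pauliTheta1 n).mulVec (pauliA n) = pauliA n := by
    funext i; fin_cases i <;> simp [pauliA, pauliTheta1]
  rw [e, pauliMonomial_A h.pow_a]

omit [NeZero n] h in
theorem monomial_theta1_b :
    pauliMonomial X Y ((pauliTheta1 n).mulVec (pauliB n)) = Y ^ (-1 : ZMod n).val := by
  simp [pauliMonomial, pauliTheta1, pauliB, Matrix.mulVec, dotProduct]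

omit [NeZero n] in
theorem monomial_theta2_a : pauliMonomial X Y ((pauliTheta2 n).mulVec (pauliA n)) = Y := by
  have e : (pauliTheta2 n).mulVec (pauliA n) = pauliB n := by
    funext i; fin_cases i <;> simp [pauliA, pauliB, pauliTheta2]
  rw [e, pauliMonomial_B h.pow_b]

omit [NeZero n] in
theorem monomial_theta2_b : pauliMonomial X Y ((pauliTheta2 n).mulVec (pauliB n)) = X := by
  have e : (pauliTheta2 n).mulVec (pauliB n) = pauliA n := by
    funext i; fin_cases i <;> simp [pauliA, pauliB, pauliTheta2]
  rw [e, pauliMonomial_A h.pow_a]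

omit [NeZero n] in
theorem monomial_theta3_a :
    pauliMonomial X Y ((pauliTheta3 n).mulVec (pauliA n)) = X * Y ^ (n / 2) := by
  have h1 := pow_val_natCast h.pow_a 1
  rw [Nat.cast_one, pow_one] at h1
  simp [-ZMod.val_natCast, pauliMonomial, pauliTheta3, pauliA, Matrix.mulVec, dotProduct, h1,
    pow_val_natCast h.pow_b]

omit [NeZero n] in
theorem monomial_theta3_b :
    pauliMonomial X Y ((pauliTheta3 n).mulVec (pauliB n)) = X ^ 2 * Y ^ (-1 : ZMod n).val := by
  have h1 := pow_val_natCast h.pow_a 2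
  rw [Nat.cast_two] at h1
  simp [pauliMonomial, pauliTheta3, pauliB, Matrix.mulVec, dotProduct, h1]

end ThetaMonomials

/-! ### Involutions with matrix θ₁ -/

section Theta1

theorem theta1_form_coeff [Nontrivial D] (hψ : IsPauliForm 𝒜 X Y (pauliTheta1 n) la lb ψ) :
    la ^ 2 = 1 ∧ la ^ n = 1 ∧ lb ^ n = 1 := by
  have hX := hψ.map_a
  have hY := hψ.map_b
  rw [h.monomial_theta1_a] at hX
  rw [monomial_theta1_b] at hY
  refine ⟨?_, hψ.isAntiHom.coeff_pow_eq_one h.pow_a h.pow_a hX,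
    hψ.isAntiHom.coeff_pow_eq_one h.pow_b h.pow_neg_one_pow hY⟩
  have h1 := hψ.involutive X
  rw [hX, map_smul, hX, smul_smul, ← sq] at h1
  have hX0 : X ≠ 0 := (IsUnit.of_pow_eq_one h.pow_a (NeZero.ne n)).ne_zero
  exact smul_left_injective F hX0 (h1.trans (one_smul F X).symm)

variable [GradedAlgebra 𝒜]

theorem existsUnique_theta1 [Nontrivial D] (hD : Module.finrank F D = n ^ 2) (ha : la ^ 2 = 1)
    (han : la ^ n = 1) (hb : lb ^ n = 1) : ∃! ψ, IsPauliForm 𝒜 X Y (pauliTheta1 n) la lb ψ := by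
  apply h.existsUnique_isPauliForm hD (by simp [pauliTheta1])
  · rw [h.monomial_theta1_a]
    exact smul_pow_eq_one han h.pow_a
  · rw [monomial_theta1_b]
    exact smul_pow_eq_one hb h.pow_neg_one_pow
  · intro ψ hψ hX hY
    rw [h.monomial_theta1_a] at hX
    rw [monomial_theta1_b] at hY
    have hb0 : lb ≠ 0 := by
      rintro rfl
      rw [zero_pow (NeZero.ne n)] at hb
      exact zero_ne_one hb
    refine ⟨by rw [hX, map_smul, hX, smul_smul, ← sq, ha, one_smul], ?_⟩
    -- No further condition arises on `Y`: applying `ψ` to `Y Y⁻¹ = 1` shows that `ψ (ψ Y)` is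
    -- inverse to `Y⁻¹`.
    have h1 := h.antiHom_pow_neg_one_mul hψ
    rw [hY, mul_smul_comm, ← smul_mul_assoc, ← map_smul, ← hY] at h1
    calc ψ (ψ Y) = ψ (ψ Y) * (Y ^ (-1 : ZMod n).val * Y) := by rw [h.pow_neg_one_mul, mul_one]
      _ = Y := by rw [← mul_assoc, h1, one_mul]

theorem theta1_isomorphic_iff [IsSimpleRing D] (hD : Module.finrank F D = n ^ 2)
    (hψ : IsPauliForm 𝒜 X Y (pauliTheta1 n) la lb ψ)
    (hψ' : IsPauliForm 𝒜 X Y (pauliTheta1 n) la' lb' ψ') :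
    InvolutionsIsomorphic 𝒜 ψ ψ' ↔ la = la' ∧ ∃ μ : F, μ ^ n = 1 ∧ lb = μ ^ 2 * lb' := by
  rw [h.isomorphic_iff hD hψ hψ']
  have hone {κ : F} (hκ : κ ^ n = 1) : κ ^ (1 : ZMod n).val = κ := by
    have := pow_val_natCast hκ 1
    rwa [Nat.cast_one, pow_one] at this
  have hneg {μ : F} (hμ : μ ^ n = 1) : μ ^ (-1 : ZMod n).val * μ = 1 := by
    have := pow_val_add hμ (-1) 1
    rw [neg_add_cancel, ZMod.val_zero, pow_zero, hone hμ] at this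
    exact this.symm
  have h00 : pauliTheta1 n 0 0 = 1 := rfl
  have h10 : pauliTheta1 n 1 0 = 0 := rfl
  have h01 : pauliTheta1 n 0 1 = 0 := rfl
  have h11 : pauliTheta1 n 1 1 = -1 := rfl
  rw [h00, h10, h01, h11]
  simp only [ZMod.val_zero, pow_zero, mul_one, one_mul]
  constructor
  · rintro ⟨κ, μ, hκ, hμ, e1, e2⟩
    rw [hone hκ] at e1
    have hκ0 : κ ≠ 0 := (IsUnit.of_pow_eq_one hκ (NeZero.ne n)).ne_zero
    refine ⟨mul_left_cancel₀ hκ0 (by rw [← e1, mul_comm]), μ, hμ, ?_⟩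
    linear_combination μ * e2 - lb * hneg hμ
  · rintro ⟨rfl, μ, hμ, rfl⟩
    refine ⟨1, μ, one_pow n, hμ, by simp, ?_⟩
    linear_combination μ * lb' * hneg hμ

theorem theta1_isomorphic_of_odd [IsSimpleRing D] (hD : Module.finrank F D = n ^ 2) (hn : Odd n)
    (hψ : IsPauliForm 𝒜 X Y (pauliTheta1 n) la lb ψ)
    (hψ' : IsPauliForm 𝒜 X Y (pauliTheta1 n) la' lb' ψ') : InvolutionsIsomorphic 𝒜 ψ ψ' := by
  obtain ⟨a2, an, bn⟩ := h.theta1_form_coeff hψ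
  obtain ⟨a2', an', bn'⟩ := h.theta1_form_coeff hψ'
  have key {c : F} (h2 : c ^ 2 = 1) (hc : c ^ n = 1) : c = 1 := by
    obtain ⟨k, hk⟩ := hn
    rwa [hk, pow_succ, pow_mul, h2, one_pow, one_mul] at hc
  rw [h.theta1_isomorphic_iff hD hψ hψ', key a2 an, key a2' an']
  have hb0 : lb' ≠ 0 := (IsUnit.of_pow_eq_one bn' (NeZero.ne n)).ne_zero
  obtain ⟨μ, hμ, e⟩ := exists_sq_of_odd hn (c := lb / lb') (by rw [div_pow, bn, bn', div_one])
  exact ⟨rfl, μ, hμ, by rw [e, div_mul_cancel₀ _ hb0]⟩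

/-- The quotient `lb / lb'` must be the square of an n-th root of unity, that is, killed by the m-th
power. -/
theorem theta1_isomorphic_iff_of_even [IsSimpleRing D] (hD : Module.finrank F D = n ^ 2) {m : ℕ}
    (hm : n = 2 * m) (hψ : IsPauliForm 𝒜 X Y (pauliTheta1 n) la lb ψ)
    (hψ' : IsPauliForm 𝒜 X Y (pauliTheta1 n) la' lb' ψ') :
    InvolutionsIsomorphic 𝒜 ψ ψ' ↔ la = la' ∧ lb ^ m = lb' ^ m := by
  rw [h.theta1_isomorphic_iff hD hψ hψ']
  refine and_congr_right fun _ => ⟨?_, fun e => ?_⟩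
  · rintro ⟨μ, hμ, rfl⟩
    rw [mul_pow, ← pow_mul, ← hm, hμ, one_mul]
  · have bn' := (h.theta1_form_coeff hψ').2.2
    have hb0 : lb' ≠ 0 := (IsUnit.of_pow_eq_one bn' (NeZero.ne n)).ne_zero
    obtain ⟨μ, hμ, e⟩ := h.primitive.exists_sq_of_pow_half (NeZero.ne n) hm (c := lb / lb')
      (by rw [div_pow, e, div_self (pow_ne_zero _ hb0)])
    exact ⟨μ, hμ, by rw [e, div_mul_cancel₀ _ hb0]⟩

omit [GradedAlgebra 𝒜] in
theorem theta1_form_coeff_of_even [Nontrivial D] {m : ℕ} (hm : n = 2 * m)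
    (hψ : IsPauliForm 𝒜 X Y (pauliTheta1 n) la lb ψ) :
    (la = 1 ∨ la = -1) ∧ (lb ^ m = 1 ∨ lb ^ m = -1) := by
  obtain ⟨a2, -, bn⟩ := h.theta1_form_coeff hψ
  refine ⟨sq_eq_one_iff.1 a2, sq_eq_one_iff.1 ?_⟩
  rw [← pow_mul, mul_comm, ← hm, bn]

theorem existsUnique_theta1_of_even [Nontrivial D] (hD : Module.finrank F D = n ^ 2) {m : ℕ}
    (hm : n = 2 * m) (ha : la = 1 ∨ la = -1) (hb : lb = 1 ∨ lb = ε) :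
    ∃! ψ, IsPauliForm 𝒜 X Y (pauliTheta1 n) la lb ψ := by
  have h2 : la ^ 2 = 1 := by rcases ha with rfl | rfl <;> norm_num
  refine h.existsUnique_theta1 hD h2 (by rw [hm, pow_mul, h2, one_pow]) ?_
  rcases hb with rfl | rfl
  · exact one_pow n
  · exact h.primitive.pow_eq_one

theorem exists_theta1_isomorphic_of_even [IsSimpleRing D] (hD : Module.finrank F D = n ^ 2)
    {m : ℕ} (hm : n = 2 * m) (hψ : IsPauliForm 𝒜 X Y (pauliTheta1 n) la lb ψ) :
    (la = 1 ∨ la = -1) ∧ ∃ lb', (lb' = 1 ∨ lb' = ε) ∧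
      ∃ ψ', IsPauliForm 𝒜 X Y (pauliTheta1 n) la lb' ψ' ∧ InvolutionsIsomorphic 𝒜 ψ ψ' := by
  obtain ⟨ha, hb⟩ := h.theta1_form_coeff_of_even hm hψ
  refine ⟨ha, ?_⟩
  rcases hb with hb | hb
  · obtain ⟨ψ', hψ', -⟩ := h.existsUnique_theta1_of_even hD hm ha (Or.inl rfl)
    exact ⟨1, Or.inl rfl, ψ', hψ', (h.theta1_isomorphic_iff_of_even hD hm hψ hψ').2
      ⟨rfl, by rw [hb, one_pow]⟩⟩
  · obtain ⟨ψ', hψ', -⟩ := h.existsUnique_theta1_of_even hD hm ha (Or.inr rfl)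
    exact ⟨ε, Or.inr rfl, ψ', hψ', (h.theta1_isomorphic_iff_of_even hD hm hψ hψ').2
      ⟨rfl, by rw [hb, h.primitive.pow_half_eq_neg_one (NeZero.ne n) hm]⟩⟩

theorem numIsoClasses_theta1_of_odd [IsSimpleRing D] (hD : Module.finrank F D = n ^ 2)
    (hn : Odd n) : numIsoClasses 𝒜 (pauliTheta1 n).mulVec = 1 := by
  obtain ⟨ψ, hψ, -⟩ := h.existsUnique_theta1 hD (one_pow 2) (one_pow n) (one_pow n)
  refine numIsoClasses_eq_one ⟨ψ, hψ.isTauInvolution⟩ fun ψ ψ' hψ hψ' => ?_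
  obtain ⟨la, lb, hψ⟩ := h.exists_isPauliForm hD hψ
  obtain ⟨la', lb', hψ'⟩ := h.exists_isPauliForm hD hψ'
  exact h.theta1_isomorphic_of_odd hD hn hψ hψ'

theorem numIsoClasses_theta1_of_even [IsSimpleRing D] (hD : Module.finrank F D = n ^ 2) {m : ℕ}
    (hm : n = 2 * m) : numIsoClasses 𝒜 (pauliTheta1 n).mulVec = 4 := by
  have hεm := h.primitive.pow_half_eq_neg_one (NeZero.ne n) hm
  have hne : (1 : F) ≠ -1 := by
    rw [← hεm]
    have := NeZero.ne n
    exact (h.primitive.pow_ne_one_of_pos_of_lt (by omega) (by omega)).symm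
  choose la lb hform using fun ψ : {ψ : D →ₗ[F] D // IsTauInvolution 𝒜 (pauliTheta1 n).mulVec ψ} =>
    h.exists_isPauliForm hD ψ.2
  let f := fun ψ => (la ψ, lb ψ ^ m)
  -- Isomorphism is equality of the invariants `(la, lb ^ m)`, so the classes correspond to their
  -- values, which fill `{1, -1}²`.
  have hker : involutionSetoid 𝒜 (pauliTheta1 n).mulVec = Setoid.ker f := by
    ext ψ ψ'
    rw [Setoid.ker_def, Prod.ext_iff]
    exact h.theta1_isomorphic_iff_of_even hD hm (hform ψ) (hform ψ')
  have hrange : Set.range f = ({1, -1} : Set F) ×ˢ ({1, -1} : Set F) := by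
    ext ⟨p, q⟩
    simp only [Set.mem_range, Set.mem_prod, Set.mem_insert_iff, Set.mem_singleton_iff]
    constructor
    · rintro ⟨ψ, hψ⟩
      obtain ⟨rfl, rfl⟩ := Prod.ext_iff.1 hψ
      exact h.theta1_form_coeff_of_even hm (hform ψ)
    · rintro ⟨hp, hq⟩
      obtain ⟨b, hb, rfl⟩ : ∃ b : F, (b = 1 ∨ b = ε) ∧ b ^ m = q := by
        rcases hq with rfl | rfl
        · exact ⟨1, Or.inl rfl, one_pow m⟩
        · exact ⟨ε, Or.inr rfl, hεm⟩
      obtain ⟨ψ, hψ, -⟩ := h.existsUnique_theta1_of_even hD hm hp hb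
      obtain ⟨e1, e2⟩ := h.isPauliForm_coeff_unique (hform ⟨ψ, hψ.isTauInvolution⟩) hψ
      exact ⟨⟨ψ, hψ.isTauInvolution⟩, by simp only [f, e1, e2]⟩
  rw [numIsoClasses, hker, Nat.card_congr (Setoid.quotientKerEquivRange f), hrange,
    Nat.card_coe_set_eq, Set.ncard_prod, Set.ncard_pair hne]

end Theta1

/-! ### Involutions with matrix θ₂ -/

section Theta2

variable [GradedAlgebra 𝒜]

theorem existsUnique_theta2 [Nontrivial D] (hD : Module.finrank F D = n ^ 2) :
    ∃! ψ, IsPauliForm 𝒜 X Y (pauliTheta2 n) 1 1 ψ := by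
  apply h.existsUnique_isPauliForm hD (by simp [pauliTheta2])
  · rw [h.monomial_theta2_a, one_smul, h.pow_b]
  · rw [h.monomial_theta2_b, one_smul, h.pow_a]
  · intro ψ hψ hX hY
    rw [h.monomial_theta2_a, one_smul] at hX
    rw [h.monomial_theta2_b, one_smul] at hY
    exact ⟨by rw [hX, hY], by rw [hY, hX]⟩

omit [GradedAlgebra 𝒜] in
theorem theta2_form_coeff [Nontrivial D] (hψ : IsPauliForm 𝒜 X Y (pauliTheta2 n) la lb ψ) :
    la ^ n = 1 ∧ la * lb = 1 := by
  have hX := hψ.map_a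
  have hY := hψ.map_b
  rw [h.monomial_theta2_a] at hX
  rw [h.monomial_theta2_b] at hY
  refine ⟨hψ.isAntiHom.coeff_pow_eq_one h.pow_a h.pow_b hX, ?_⟩
  have h1 := hψ.involutive X
  rw [hX, map_smul, hY, smul_smul] at h1
  have hX0 : X ≠ 0 := (IsUnit.of_pow_eq_one h.pow_a (NeZero.ne n)).ne_zero
  exact smul_left_injective F hX0 (h1.trans (one_smul F X).symm)

theorem theta2_isomorphic [IsSimpleRing D] (hD : Module.finrank F D = n ^ 2)
    (hψ : IsPauliForm 𝒜 X Y (pauliTheta2 n) la lb ψ)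
    (hψ' : IsPauliForm 𝒜 X Y (pauliTheta2 n) la' lb' ψ') : InvolutionsIsomorphic 𝒜 ψ ψ' := by
  rw [h.isomorphic_iff hD hψ hψ']
  obtain ⟨an, ab⟩ := h.theta2_form_coeff hψ
  obtain ⟨an', ab'⟩ := h.theta2_form_coeff hψ'
  have hone {κ : F} (hκ : κ ^ n = 1) : κ ^ (1 : ZMod n).val = κ := by
    have := pow_val_natCast hκ 1
    rwa [Nat.cast_one, pow_one] at this
  have h00 : pauliTheta2 n 0 0 = 0 := rfl
  have h10 : pauliTheta2 n 1 0 = 1 := rfl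
  have h01 : pauliTheta2 n 0 1 = 1 := rfl
  have h11 : pauliTheta2 n 1 1 = 0 := rfl
  rw [h00, h10, h01, h11]
  simp only [ZMod.val_zero, pow_zero, mul_one, one_mul]
  -- The equations are `la μ = κ la'` and `lb κ = μ lb'`; the first suggests `κ = la`, `μ = la'`,
  -- and the second becomes `1 = 1`.
  refine ⟨la, la', an, an', ?_, ?_⟩
  · rw [hone an']
  · rw [hone an, mul_comm, ab, ab']

theorem numIsoClasses_theta2 [IsSimpleRing D] (hD : Module.finrank F D = n ^ 2) :
    numIsoClasses 𝒜 (pauliTheta2 n).mulVec = 1 := by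
  obtain ⟨ψ, hψ, -⟩ := h.existsUnique_theta2 hD
  refine numIsoClasses_eq_one ⟨ψ, hψ.isTauInvolution⟩ fun ψ ψ' hψ hψ' => ?_
  obtain ⟨la, lb, hψ⟩ := h.exists_isPauliForm hD hψ
  obtain ⟨la', lb', hψ'⟩ := h.exists_isPauliForm hD hψ'
  exact h.theta2_isomorphic hD hψ hψ'

end Theta2

end IsPauliGenerators

/-! ### Involutions with matrix θ₃ -/

namespace IsPauliGenerators

variable {F D : Type*} [Field F] [Ring D] [Algebra F D] {n : ℕ} [NeZero n]
  {𝒜 : PauliGroup n → Submodule F D} {ε : F} {X Y : D}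
  {la lb la' lb' : F} {ψ ψ' : D →ₗ[F] D}
  (h : IsPauliGenerators 𝒜 ε X Y)
include h

section Half

variable {m : ℕ} (hm : n = 2 * m)
include hm

theorem pow_half_mul : Y ^ m * X = -(X * Y ^ m) := by
  have h1 := pow_mul_pow_comm_smul h.comm 1 m
  rw [one_mul, pow_one, h.primitive.pow_half_eq_neg_one (NeZero.ne n) hm, neg_one_smul] at h1
  rw [h1, neg_neg]

theorem mul_pow_half : X ^ m * Y = -(Y * X ^ m) := by
  rw [pow_mul_comm_smul h.comm, h.primitive.pow_half_eq_neg_one (NeZero.ne n) hm, neg_one_smul]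

omit [NeZero n] in
theorem pow_half_mul_self : Y ^ m * Y ^ m = 1 := by
  rw [← pow_add, ← two_mul, ← hm, h.pow_b]

/-- `Y ^ m` anticommutes with `X` and squares to 1. -/
theorem mul_pow_half_sq : (X * Y ^ m) * (X * Y ^ m) = -X ^ 2 := by
  calc _ = X * (Y ^ m * X) * Y ^ m := by simp only [mul_assoc]
    _ = -(X * X * (Y ^ m * Y ^ m)) := by
        rw [h.pow_half_mul hm, mul_neg, neg_mul]; simp only [mul_assoc]
    _ = _ := by rw [h.pow_half_mul_self hm, mul_one, sq]

theorem mul_pow_half_pow (hm2 : Even m) : (X * Y ^ m) ^ n = 1 := by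
  rw [hm, pow_mul, sq, h.mul_pow_half_sq hm, hm2.neg_pow, ← pow_mul, ← hm, h.pow_a]

omit hm in
theorem pow_neg_one_mul_comm : Y ^ (-1 : ZMod n).val * X = ε • (X * Y ^ (-1 : ZMod n).val) := by
  have h1 : Y ^ (-1 : ZMod n).val * (X * Y) * Y ^ (-1 : ZMod n).val =
      Y ^ (-1 : ZMod n).val * X := by
    rw [mul_assoc, mul_assoc, h.mul_pow_neg_one, mul_one]
  rw [← h1, h.comm, mul_smul_comm, smul_mul_assoc, ← mul_assoc, h.pow_neg_one_mul, one_mul]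

-- Moving `X²` past the j-th accumulated power of `Y⁻¹` costs `ε ^ (2 j)`; summing over `j < k`
-- gives the exponent `k (k - 1)`.
omit hm in
theorem sq_mul_pow_neg_one_pow (k : ℕ) : (X ^ 2 * Y ^ (-1 : ZMod n).val) ^ k =
    ε ^ (k * (k - 1)) • (X ^ (2 * k) * (Y ^ (-1 : ZMod n).val) ^ k) := by
  induction k with
  | zero => simp
  | succ k ih =>
    have h1 := pow_mul_pow_comm_smul h.pow_neg_one_mul_comm k 2
    set Z := Y ^ (-1 : ZMod n).val
    calc (X ^ 2 * Z) ^ (k + 1) = ε ^ (k * (k - 1)) • (X ^ (2 * k) * (Z ^ k * X ^ 2) * Z) := by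
          rw [pow_succ, ih, smul_mul_assoc]; simp only [mul_assoc]
      _ = (ε ^ (k * (k - 1)) * ε ^ (k * 2)) • (X ^ (2 * k) * X ^ 2 * (Z ^ k * Z)) := by
          rw [h1, mul_smul_comm, smul_mul_assoc, smul_smul]; simp only [mul_assoc]
      _ = _ := by
          rw [← pow_add, ← pow_add, ← pow_succ, Nat.add_sub_cancel]
          congr 2
          cases k with
          | zero => rfl
          | succ k => rw [Nat.add_sub_cancel]; ring

theorem sq_mul_pow_neg_one_pow_half (hm2 : Even m) :
    (X ^ 2 * Y ^ (-1 : ZMod n).val) ^ m = -Y ^ m := by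
  have hm0 : m ≠ 0 := by have := NeZero.ne n; omega
  have hodd : Odd (m - 1) := Nat.Even.sub_odd (Nat.one_le_iff_ne_zero.2 hm0) hm2 odd_one
  rw [h.sq_mul_pow_neg_one_pow, pow_mul, h.primitive.pow_half_eq_neg_one (NeZero.ne n) hm,
    hodd.neg_one_pow, ← hm, h.pow_a, one_mul, h.pow_neg_one_pow_half hm, neg_one_smul]

theorem sq_mul_pow_neg_one_pow_self (hm2 : Even m) : (X ^ 2 * Y ^ (-1 : ZMod n).val) ^ n = 1 := by
  have e (x : D) : x ^ n = (x ^ m) ^ 2 := by rw [← pow_mul, mul_comm, ← hm]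
  rw [e, h.sq_mul_pow_neg_one_pow_half hm hm2, neg_sq, sq, h.pow_half_mul_self hm]

end Half

section Theta3

/-- Setting both scalars equal to 1 yields precisely the conditions `la² = -1` and `lb ^ m = -1` on
the coefficients. -/
theorem theta3_apply_apply {m : ℕ} (hm : n = 2 * m) (hm2 : Even m) (hψ : IsAntiHom ψ)
    (hX : ψ X = la • (X * Y ^ m)) (hY : ψ Y = lb • (X ^ 2 * Y ^ (-1 : ZMod n).val)) :
    ψ (ψ X) = (la ^ 2 * lb ^ m) • X ∧ ψ (ψ Y) = (-la ^ 2) • Y := by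
  constructor
  · have h1 : -Y ^ m * (X * Y ^ m) = X := by
      rw [neg_mul, ← mul_assoc, h.pow_half_mul hm, neg_mul, neg_neg, mul_assoc,
        h.pow_half_mul_self hm, mul_one]
    conv_lhs => rw [hX]
    rw [map_smul, hψ.map_mul, hψ.map_pow, hX, hY, smul_pow, h.sq_mul_pow_neg_one_pow_half hm hm2,
      smul_mul_smul_comm, smul_smul, h1]
    congr 1
    ring
  · have h1 := h.antiHom_pow_neg_one_mul hψ
    have h2 : lb • X ^ 2 = ψ Y * Y := by
      rw [hY, smul_mul_assoc, mul_assoc, h.pow_neg_one_mul, mul_one]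
    have h3 : ψ X * ψ X = (-la ^ 2) • X ^ 2 := by
      rw [hX, smul_mul_smul_comm, h.mul_pow_half_sq hm, smul_neg, neg_smul, sq la]
    conv_lhs => rw [hY]
    rw [map_smul, hψ.map_mul, sq X, hψ.map_mul, h3, mul_smul_comm, smul_comm, ← mul_smul_comm, h2,
      ← mul_assoc, h1, one_mul]

theorem theta3_form_coeff [Nontrivial D] {m : ℕ} (hm : n = 2 * m) (hm2 : Even m)
    (hψ : IsPauliForm 𝒜 X Y (pauliTheta3 n) la lb ψ) : la ^ 2 = -1 ∧ lb ^ m = -1 := by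
  have hX := hψ.map_a
  have hY := hψ.map_b
  have hm' : n / 2 = m := by omega
  rw [h.monomial_theta3_a, hm'] at hX
  rw [h.monomial_theta3_b] at hY
  obtain ⟨e1, e2⟩ := h.theta3_apply_apply hm hm2 hψ.isAntiHom hX hY
  rw [hψ.involutive] at e1 e2
  have hX0 : X ≠ 0 := (IsUnit.of_pow_eq_one h.pow_a (NeZero.ne n)).ne_zero
  have hY0 : Y ≠ 0 := (IsUnit.of_pow_eq_one h.pow_b (NeZero.ne n)).ne_zero
  have f1 : 1 = la ^ 2 * lb ^ m := smul_left_injective F hX0 ((one_smul F X).trans e1)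
  have f2 : 1 = -la ^ 2 := smul_left_injective F hY0 ((one_smul F Y).trans e2)
  have f3 : la ^ 2 = -1 := by rw [f2, neg_neg]
  exact ⟨f3, by rw [f3] at f1; linear_combination f1⟩

variable [GradedAlgebra 𝒜]

theorem existsUnique_theta3 [Nontrivial D] (hD : Module.finrank F D = n ^ 2) {m : ℕ}
    (hm : n = 2 * m) (hm2 : Even m) (ha : la ^ 2 = -1) (hb : lb ^ m = -1) :
    ∃! ψ, IsPauliForm 𝒜 X Y (pauliTheta3 n) la lb ψ := by
  have hm' : n / 2 = m := by omega
  have hcast : (2 : ZMod n) * ((m : ℕ) : ZMod n) = 0 := by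
    have : ((2 * m : ℕ) : ZMod n) = 0 := by rw [← hm, ZMod.natCast_self]
    exact_mod_cast this
  apply h.existsUnique_isPauliForm hD
  · rw [pauliTheta3, Matrix.det_fin_two_of, hm']
    linear_combination -hcast
  · rw [h.monomial_theta3_a, hm']
    exact smul_pow_eq_one (by rw [hm, pow_mul, ha, hm2.neg_one_pow]) (h.mul_pow_half_pow hm hm2)
  · rw [h.monomial_theta3_b]
    exact smul_pow_eq_one (by rw [hm, mul_comm, pow_mul, hb, neg_one_sq])
      (h.sq_mul_pow_neg_one_pow_self hm hm2)
  · intro ψ hψ hX hY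
    rw [h.monomial_theta3_a, hm'] at hX
    rw [h.monomial_theta3_b] at hY
    obtain ⟨e1, e2⟩ := h.theta3_apply_apply hm hm2 hψ hX hY
    rw [ha, hb, neg_mul_neg, one_mul, one_smul] at e1
    rw [ha, neg_neg, one_smul] at e2
    exact ⟨e1, e2⟩

theorem theta3_isomorphic [IsSimpleRing D] (hD : Module.finrank F D = n ^ 2) {m : ℕ}
    (hm : n = 2 * m) (hm2 : Even m) (hψ : IsPauliForm 𝒜 X Y (pauliTheta3 n) la lb ψ)
    (hψ' : IsPauliForm 𝒜 X Y (pauliTheta3 n) la' lb' ψ') : InvolutionsIsomorphic 𝒜 ψ ψ' := by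
  rw [h.isomorphic_iff hD hψ hψ']
  obtain ⟨ha, hb⟩ := h.theta3_form_coeff hm hm2 hψ
  obtain ⟨ha', hb'⟩ := h.theta3_form_coeff hm hm2 hψ'
  have hm0 : m ≠ 0 := by have := NeZero.ne n; omega
  have hm' : n / 2 = m := by omega
  have hb0 : lb ≠ 0 := by
    rintro rfl
    rw [zero_pow hm0] at hb
    exact neg_ne_zero.2 one_ne_zero hb.symm
  obtain ⟨ρ, hρ, eρ⟩ := h.primitive.exists_sq_of_pow_half (NeZero.ne n) hm (c := lb' / lb)
    (by rw [div_pow, hb, hb', div_self (neg_ne_zero.2 one_ne_zero)])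
  -- The equations to solve are `la μ ^ m = la'` and `lb κ² = μ² lb'`. As `la' = ± la`, the first is
  -- met by `μ = 1` or `μ = ε`; then `κ = ρ μ` settles the second.
  obtain ⟨μ, hμ, eμ⟩ : ∃ μ : F, μ ^ n = 1 ∧ la * μ ^ m = la' := by
    have : (la' - la) * (la' + la) = 0 := by linear_combination ha' - ha
    rcases mul_eq_zero.1 this with e | e
    · exact ⟨1, one_pow n, by linear_combination la * (one_pow m : (1 : F) ^ m = 1) - e⟩
    · exact ⟨ε, h.primitive.pow_eq_one, by
        rw [h.primitive.pow_half_eq_neg_one (NeZero.ne n) hm]; linear_combination -e⟩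
  have hone {κ : F} (hκ : κ ^ n = 1) : κ ^ (1 : ZMod n).val = κ := by
    have := pow_val_natCast hκ 1
    rwa [Nat.cast_one, pow_one] at this
  have htwo {κ : F} (hκ : κ ^ n = 1) : κ ^ (2 : ZMod n).val = κ ^ 2 := by
    have := pow_val_natCast hκ 2
    rwa [Nat.cast_two] at this
  have hneg : μ ^ (-1 : ZMod n).val * μ = 1 := by
    have := pow_val_add hμ (-1) 1
    rw [neg_add_cancel, ZMod.val_zero, pow_zero, hone hμ] at this
    exact this.symm
  have h00 : pauliTheta3 n 0 0 = 1 := rfl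
  have h10 : pauliTheta3 n 1 0 = ((n / 2 : ℕ) : ZMod n) := rfl
  have h01 : pauliTheta3 n 0 1 = 2 := rfl
  have h11 : pauliTheta3 n 1 1 = -1 := rfl
  have hκ : (ρ * μ) ^ n = 1 := by rw [mul_pow, hρ, hμ, one_mul]
  refine ⟨ρ * μ, μ, hκ, hμ, ?_, ?_⟩
  · rw [h00, h10, pow_val_natCast hμ, hone hκ, hm', ← eμ]
    ring
  · have e : lb * ρ ^ 2 = lb' := by rw [eρ, mul_div_cancel₀ _ hb0]
    rw [h01, h11, htwo hκ, ← e]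
    linear_combination lb * ρ ^ 2 * μ * hneg

theorem numIsoClasses_theta3 [IsSimpleRing D] (hD : Module.finrank F D = n ^ 2) (hn : 4 ∣ n) :
    numIsoClasses 𝒜 (pauliTheta3 n).mulVec = 1 := by
  obtain ⟨k, hk⟩ := hn
  have hm : n = 2 * (2 * k) := by omega
  have hε := h.primitive.pow_half_eq_neg_one (NeZero.ne n) hm
  obtain ⟨ψ, hψ, -⟩ := h.existsUnique_theta3 hD hm (even_two_mul k) (la := ε ^ k) (lb := ε)
    (by rw [← pow_mul, mul_comm, hε]) hε
  refine numIsoClasses_eq_one ⟨ψ, hψ.isTauInvolution⟩ fun ψ ψ' hψ hψ' => ?_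
  obtain ⟨la, lb, hψ⟩ := h.exists_isPauliForm hD hψ
  obtain ⟨la', lb', hψ'⟩ := h.exists_isPauliForm hD hψ'
  exact h.theta3_isomorphic hD hm (even_two_mul k) hψ hψ'

end Theta3

/-! ### Equivalences between non-isomorphic θ₁ involutions -/

section Theta1Equivalence

variable [GradedAlgebra 𝒜] [IsAlgClosed F] [IsSimpleRing D] (hD : Module.finrank F D = n ^ 2)
  {m : ℕ} (hm : n = 2 * m)
include hD hm

/-- The automorphism is `X ↦ c X Y ^ m`, `Y ↦ Y`: as `Y ^ m` anticommutes with `X`, the involution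
with `la = -1` fixes `X Y ^ m`. -/
theorem theta1_neg_one_equivalent (hψ : IsPauliForm 𝒜 X Y (pauliTheta1 n) (-1) 1 ψ)
    (hψ' : IsPauliForm 𝒜 X Y (pauliTheta1 n) 1 1 ψ') : InvolutionsEquivalent 𝒜 ψ ψ' := by
  let M : Matrix (Fin 2) (Fin 2) (ZMod n) := !![1, 0; (m : ZMod n), 1]
  have hMa : M.mulVec (pauliA n) = pauliA n + m • pauliB n := by
    funext i; fin_cases i <;> simp [M, pauliA, pauliB]
  have hMb : M.mulVec (pauliB n) = pauliB n := by
    funext i; fin_cases i <;> simp [M, pauliB]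
  have hXu := IsUnit.of_pow_eq_one h.pow_a (NeZero.ne n)
  have hYu := IsUnit.of_pow_eq_one h.pow_b (NeZero.ne n)
  have hmem : X * Y ^ m ∈ 𝒜 (M.mulVec (pauliA n)) := by
    rw [hMa]
    exact SetLike.mul_mem_graded h.mem_a (SetLike.pow_mem_graded m h.mem_b)
  obtain ⟨c, -, hc⟩ := exists_pow_eq_one_of_mem_graded hD h.support_eq hmem (hXu.mul (hYu.pow m))
  obtain ⟨φ, hφX, hφY⟩ := h.exists_algEquiv hD hc h.pow_b (by
    rw [smul_mul_assoc, mul_smul_comm, smul_comm ε, ← mul_assoc, ← smul_mul_assoc ε, ← h.comm,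
      mul_assoc, mul_assoc, ← pow_succ, ← pow_succ'])
  have hX := hψ.map_a
  have hY := hψ.map_b
  have hX' := hψ'.map_a
  have hY' := hψ'.map_b
  rw [h.monomial_theta1_a] at hX hX'
  rw [monomial_theta1_b] at hY hY'
  rw [one_smul] at hY hX' hY'
  refine (h.equivalent_of_generators hD (M := M) (by simp [M]) ?_ ?_ hψ'.isAntiHom hψ.isAntiHom
    (φ := φ) ?_ ?_).symm
  · rw [hφX]
    exact Submodule.smul_mem _ _ hmem
  · rw [hφY, hMb]
    exact h.mem_b
  · rw [hX', hφX, map_smul, hψ.isAntiHom.map_mul, hψ.isAntiHom.map_pow, hX, hY,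
      h.pow_neg_one_pow_half hm, neg_one_smul, mul_neg, h.pow_half_mul hm, neg_neg]
  · rw [hY', map_pow, hφY, hY]

/-- The automorphism is `X ↦ X`, `Y ↦ κ Y X ^ m` with `κ² = ε⁻¹`, chosen so that `ψ` inverts the
image of `Y`. For odd `m` both `(Y X ^ m) ^ n` and `κ ^ n` are -1, so the image of `Y` has n-th
power 1. -/
theorem theta1_root_equivalent (hm2 : Odd m) (hψ : IsPauliForm 𝒜 X Y (pauliTheta1 n) 1 ε ψ)
    (hψ' : IsPauliForm 𝒜 X Y (pauliTheta1 n) 1 1 ψ') : InvolutionsEquivalent 𝒜 ψ ψ' := by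
  let M : Matrix (Fin 2) (Fin 2) (ZMod n) := !![1, (m : ZMod n); 0, 1]
  have hMa : M.mulVec (pauliA n) = pauliA n := by
    funext i; fin_cases i <;> simp [M, pauliA]
  have hMb : M.mulVec (pauliB n) = pauliB n + m • pauliA n := by
    funext i; fin_cases i <;> simp [M, pauliA, pauliB]
  have hεm := h.primitive.pow_half_eq_neg_one (NeZero.ne n) hm
  have hε0 : ε ≠ 0 := h.primitive.ne_zero (NeZero.ne n)
  have hXm : X ^ m * X ^ m = 1 := by rw [← pow_add, ← two_mul, ← hm, h.pow_a]
  obtain ⟨κ, hκ⟩ := IsAlgClosed.exists_pow_nat_eq ε⁻¹ two_pos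
  have hκε : κ ^ 2 * ε = 1 := by rw [hκ, inv_mul_cancel₀ hε0]
  have hy : (κ • (Y * X ^ m)) ^ n = 1 := by
    have h1 : (Y * X ^ m) ^ 2 = -Y ^ 2 := by
      calc _ = Y * (X ^ m * Y) * X ^ m := by rw [sq]; simp only [mul_assoc]
        _ = -(Y * Y * (X ^ m * X ^ m)) := by
            rw [h.mul_pow_half hm, mul_neg, neg_mul]; simp only [mul_assoc]
        _ = _ := by rw [hXm, mul_one, sq]
    have h2 : (Y * X ^ m) ^ n = -1 := by
      rw [hm, pow_mul, h1, hm2.neg_pow, ← pow_mul, ← hm, h.pow_b]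
    have h3 : κ ^ n = -1 := by
      rw [hm, pow_mul, hκ, inv_pow, hεm, inv_neg, inv_one]
    rw [smul_pow, h2, h3, neg_one_smul, neg_neg]
  obtain ⟨φ, hφX, hφY⟩ := h.exists_algEquiv hD h.pow_a hy (by
    rw [smul_mul_assoc, mul_smul_comm, smul_comm ε, ← mul_assoc, h.comm, smul_mul_assoc, mul_assoc,
      mul_assoc, ← pow_succ, ← pow_succ'])
  have hX := hψ.map_a
  have hY := hψ.map_b
  have hX' := hψ'.map_a
  have hY' := hψ'.map_b
  rw [h.monomial_theta1_a] at hX hX'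
  rw [monomial_theta1_b] at hY hY'
  rw [one_smul] at hX hX' hY'
  refine (h.equivalent_of_generators hD (M := M) (by simp [M]) ?_ ?_ hψ'.isAntiHom hψ.isAntiHom
    (φ := φ) ?_ ?_).symm
  · rw [hφX, hMa]
    exact h.mem_a
  · rw [hφY, hMb]
    exact Submodule.smul_mem _ _ (SetLike.mul_mem_graded h.mem_b (SetLike.pow_mem_graded m h.mem_a))
  · rw [hX', hφX, hX]
  · have h1 : φ (Y ^ (-1 : ZMod n).val) * (κ • (Y * X ^ m)) = 1 := by
      rw [← hφY, ← map_mul, h.pow_neg_one_mul, map_one]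
    have h2 : (κ • (X ^ m * (ε • Y ^ (-1 : ZMod n).val))) * (κ • (Y * X ^ m)) = 1 := by
      rw [smul_mul_smul_comm, mul_smul_comm, smul_mul_assoc, smul_smul, mul_assoc (X ^ m),
        ← mul_assoc _ Y (X ^ m), h.pow_neg_one_mul, one_mul, hXm, ← sq, hκε, one_smul]
    rw [hY', hφY, map_smul, hψ.isAntiHom.map_mul, hψ.isAntiHom.map_pow, hX, hY]
    exact (IsUnit.of_pow_eq_one hy (NeZero.ne n)).mul_right_cancel (h1.trans h2.symm)

end Theta1Equivalence

end IsPauliGenerators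

/-! ### Existence, normal forms and the main theorem -/

namespace IsPauliGenerators

variable {F D : Type*} [Field F] [Ring D] [Algebra F D] {n : ℕ} [NeZero n]
  {𝒜 : PauliGroup n → Submodule F D} [GradedAlgebra 𝒜] {ε : F} {X Y : D}
  [IsAlgClosed F] [IsSimpleRing D] (h : IsPauliGenerators 𝒜 ε X Y)
  (hD : Module.finrank F D = n ^ 2)
include h hD

theorem exists_isTauInvolution {τ : Matrix (Fin 2) (Fin 2) (ZMod n)} (hd : τ.det = -1)
    (ht : τ.trace = 0) : ∃ ψ, IsTauInvolution 𝒜 τ.mulVec ψ := by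
  -- An involution for the normal form is carried back to `τ` by an automorphism inducing the
  -- conjugation.
  have key {θ : Matrix (Fin 2) (Fin 2) (ZMod n)} {la lb : F} (hτ : SLConj τ θ)
      (hθ : ∃! ψ, IsPauliForm 𝒜 X Y θ la lb ψ) : ∃ ψ, IsTauInvolution 𝒜 τ.mulVec ψ := by
    obtain ⟨ψ, hψ, -⟩ := hθ
    obtain ⟨ψ', hψ', -⟩ := h.exists_equivalent_of_slConj hD hτ.symm hψ.isTauInvolution
    exact ⟨ψ', hψ'⟩
  have h1 := h.existsUnique_theta1 hD (one_pow 2) (one_pow n) (one_pow n)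
  rcases Nat.even_or_odd n with hn | hn
  · rcases slConj_classification_even hn hd ht with hτ | hτ | ⟨⟨k, hk⟩, hτ⟩
    · exact key hτ h1
    · exact key hτ (h.existsUnique_theta2 hD)
    · have hm : n = 2 * (2 * k) := by omega
      have hε := h.primitive.pow_half_eq_neg_one (NeZero.ne n) hm
      exact key hτ (h.existsUnique_theta3 hD hm (even_two_mul k) (la := ε ^ k) (lb := ε)
        (by rw [← pow_mul, mul_comm, hε]) hε)
  · obtain ⟨x, y, z, rfl, e⟩ := exists_eq_of_trace_eq_zero hd ht
    exact key (slConj_theta1_of_odd hn e) h1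

/-- A homogeneous involution is equivalent to one in Pauli form for any matrix conjugate to its
own. -/
theorem exists_equivalent_isPauliForm {τ θ : Matrix (Fin 2) (Fin 2) (ZMod n)} {ψ : D →ₗ[F] D}
    (hψ : IsTauInvolution 𝒜 τ.mulVec ψ) (hτ : SLConj τ θ) :
    ∃ la lb ψ', IsPauliForm 𝒜 X Y θ la lb ψ' ∧ InvolutionsEquivalent 𝒜 ψ ψ' := by
  obtain ⟨ψ', hψ', e⟩ := h.exists_equivalent_of_slConj hD hτ hψ
  obtain ⟨la, lb, hf⟩ := h.exists_isPauliForm hD hψ'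
  exact ⟨la, lb, ψ', hf, e⟩

theorem hasNormalForms_of_odd (hn : Odd n) : HasNormalForms 𝒜 X Y [(pauliTheta1 n, 1, 1)] := by
  have h1 := h.existsUnique_theta1 hD (one_pow 2) (one_pow n) (one_pow n)
  refine ⟨by simpa using h1, ?_⟩
  rintro ψ ⟨τ, hψ⟩
  obtain ⟨M, hM, hd, ht⟩ := h.exists_matrix_of_isTauInvolution hD hψ
  rw [hM] at hψ
  obtain ⟨x, y, z, rfl, e⟩ := exists_eq_of_trace_eq_zero hd ht
  obtain ⟨la, lb, ψ', hf, e'⟩ := h.exists_equivalent_isPauliForm hD hψ (slConj_theta1_of_odd hn e)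
  obtain ⟨ψ₁, hψ₁, -⟩ := h1
  exact ⟨(pauliTheta1 n, 1, 1), by simp, ψ₁, hψ₁,
    e'.trans (h.theta1_isomorphic_of_odd hD hn hf hψ₁).equivalent⟩

/-- For even `n`, the involutions with matrix `θ₁` have three equivalent normal forms. -/
theorem exists_theta1_equivalent_of_even {m : ℕ} (hm : n = 2 * m) {la lb : F} {ψ : D →ₗ[F] D}
    (hψ : IsPauliForm 𝒜 X Y (pauliTheta1 n) la lb ψ) :
    ∃ p ∈ [((1 : F), (1 : F)), (1, ε), (-1, ε)], ∃ ψ',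
      IsPauliForm 𝒜 X Y (pauliTheta1 n) p.1 p.2 ψ' ∧ InvolutionsEquivalent 𝒜 ψ ψ' := by
  obtain ⟨ha, lb', hb, ψ', hψ', e⟩ := h.exists_theta1_isomorphic_of_even hD hm hψ
  rcases ha with rfl | rfl <;> rcases hb with rfl | rfl
  · exact ⟨(1, 1), by simp, ψ', hψ', e.equivalent⟩
  · exact ⟨(1, lb'), by simp, ψ', hψ', e.equivalent⟩
  · obtain ⟨ψ₁, hψ₁, -⟩ := h.existsUnique_theta1 hD (one_pow 2) (one_pow n) (one_pow n)
    exact ⟨(1, 1), by simp, ψ₁, hψ₁,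
      e.equivalent.trans (h.theta1_neg_one_equivalent hD hm hψ' hψ₁)⟩
  · exact ⟨(-1, lb'), by simp, ψ', hψ', e.equivalent⟩

theorem hasNormalForms_of_even (hn : Even n) (h4 : ¬ 4 ∣ n) : HasNormalForms 𝒜 X Y
    [(pauliTheta1 n, 1, 1), (pauliTheta1 n, -1, ε), (pauliTheta2 n, 1, 1)] := by
  obtain ⟨m, hm⟩ := hn.two_dvd
  have hm2 : Odd m := Nat.odd_iff.2 (by omega)
  have h1 := h.existsUnique_theta1_of_even hD hm (Or.inl rfl) (Or.inl rfl)
  have h2 := h.existsUnique_theta1_of_even hD hm (Or.inr rfl) (Or.inr rfl)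
  have h3 := h.existsUnique_theta2 hD
  refine ⟨by simpa using ⟨h1, h2, h3⟩, ?_⟩
  rintro ψ ⟨τ, hψ⟩
  obtain ⟨M, hM, hd, ht⟩ := h.exists_matrix_of_isTauInvolution hD hψ
  rw [hM] at hψ
  rcases slConj_classification_even hn hd ht with hτ | hτ | ⟨h4', -⟩
  · obtain ⟨la, lb, ψ', hf, e⟩ := h.exists_equivalent_isPauliForm hD hψ hτ
    obtain ⟨p, hp, ψ₁, hψ₁, e₁⟩ := h.exists_theta1_equivalent_of_even hD hm hf
    simp only [List.mem_cons, List.not_mem_nil, or_false] at hp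
    rcases hp with rfl | rfl | rfl
    · exact ⟨(pauliTheta1 n, 1, 1), by simp, ψ₁, hψ₁, e.trans e₁⟩
    · obtain ⟨ψ₂, hψ₂, -⟩ := h1
      exact ⟨(pauliTheta1 n, 1, 1), by simp, ψ₂, hψ₂,
        (e.trans e₁).trans (h.theta1_root_equivalent hD hm hm2 hψ₁ hψ₂)⟩
    · exact ⟨(pauliTheta1 n, -1, ε), by simp, ψ₁, hψ₁, e.trans e₁⟩
  · obtain ⟨la, lb, ψ', hf, e⟩ := h.exists_equivalent_isPauliForm hD hψ hτ
    obtain ⟨ψ₁, hψ₁, -⟩ := h3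
    exact ⟨(pauliTheta2 n, 1, 1), by simp, ψ₁, hψ₁,
      e.trans (h.theta2_isomorphic hD hf hψ₁).equivalent⟩
  · exact absurd h4' h4

theorem hasNormalForms_of_four_dvd (h4 : 4 ∣ n) : HasNormalForms 𝒜 X Y
    [(pauliTheta1 n, 1, 1), (pauliTheta1 n, 1, ε), (pauliTheta1 n, -1, ε),
      (pauliTheta2 n, 1, 1), (pauliTheta3 n, ε ^ (n / 4), ε)] := by
  obtain ⟨k, hk⟩ := h4
  have hm : n = 2 * (2 * k) := by omega
  have hn : Even n := by rw [hm]; exact even_two_mul _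
  have hε := h.primitive.pow_half_eq_neg_one (NeZero.ne n) hm
  have hk' : n / 4 = k := by omega
  have h1 := h.existsUnique_theta1_of_even hD hm (Or.inl rfl) (Or.inl rfl)
  have h2 := h.existsUnique_theta1_of_even hD hm (Or.inl rfl) (Or.inr rfl)
  have h3 := h.existsUnique_theta1_of_even hD hm (Or.inr rfl) (Or.inr rfl)
  have h5 := h.existsUnique_theta2 hD
  have h6 := h.existsUnique_theta3 hD hm (even_two_mul k) (la := ε ^ (n / 4)) (lb := ε)
    (by rw [hk', ← pow_mul, mul_comm, hε]) hε
  refine ⟨by simpa using ⟨h1, h2, h3, h5, h6⟩, ?_⟩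
  rintro ψ ⟨τ, hψ⟩
  obtain ⟨M, hM, hd, ht⟩ := h.exists_matrix_of_isTauInvolution hD hψ
  rw [hM] at hψ
  rcases slConj_classification_even hn hd ht with hτ | hτ | ⟨-, hτ⟩
  · obtain ⟨la, lb, ψ', hf, e⟩ := h.exists_equivalent_isPauliForm hD hψ hτ
    obtain ⟨p, hp, ψ₁, hψ₁, e₁⟩ := h.exists_theta1_equivalent_of_even hD hm hf
    refine ⟨(pauliTheta1 n, p.1, p.2), ?_, ψ₁, hψ₁, e.trans e₁⟩
    simp only [List.mem_cons, List.not_mem_nil, or_false] at hp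
    rcases hp with rfl | rfl | rfl <;> simp
  · obtain ⟨la, lb, ψ', hf, e⟩ := h.exists_equivalent_isPauliForm hD hψ hτ
    obtain ⟨ψ₁, hψ₁, -⟩ := h5
    exact ⟨(pauliTheta2 n, 1, 1), by simp, ψ₁, hψ₁,
      e.trans (h.theta2_isomorphic hD hf hψ₁).equivalent⟩
  · obtain ⟨la, lb, ψ', hf, e⟩ := h.exists_equivalent_isPauliForm hD hψ hτ
    obtain ⟨ψ₁, hψ₁, -⟩ := h6
    exact ⟨(pauliTheta3 n, ε ^ (n / 4), ε), by simp, ψ₁, hψ₁,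
      e.trans (h.theta3_isomorphic hD hm (even_two_mul k) hf hψ₁).equivalent⟩

end IsPauliGenerators

theorem mainTheorem1 {F : Type*} [Field F] [IsAlgClosed F] (n : ℕ) [NeZero n]
    (hchar : ringChar F ≠ n)
    (𝒜 : PauliGroup n → Submodule F (Matrix (Fin n) (Fin n) F)) [GradedAlgebra 𝒜]
    (hdiv : IsDivisionGrading 𝒜) (hsupp : gradingSupport 𝒜 = Set.univ) :
    -- existence
    (∀ τ : Matrix.GeneralLinearGroup (Fin 2) (ZMod n),
      τ.val.det = -1 → τ.val.trace = 0 → ∃ ψ, IsTauInvolution 𝒜 τ.val.mulVec ψ) ∧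
    -- standard generators exist, and the normal forms below hold for every choice of them
    (∃ (ε : F) (Xa Xb : Matrix (Fin n) (Fin n) F), IsPauliGenerators 𝒜 ε Xa Xb) ∧
    (∀ (ε : F) (Xa Xb : Matrix (Fin n) (Fin n) F), IsPauliGenerators 𝒜 ε Xa Xb →
      (Odd n → HasNormalForms 𝒜 Xa Xb [(pauliTheta1 n, 1, 1)]) ∧
      (Even n → ¬ 4 ∣ n → HasNormalForms 𝒜 Xa Xb
        [(pauliTheta1 n, 1, 1), (pauliTheta1 n, -1, ε), (pauliTheta2 n, 1, 1)]) ∧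
      (4 ∣ n → HasNormalForms 𝒜 Xa Xb
        [(pauliTheta1 n, 1, 1), (pauliTheta1 n, 1, ε), (pauliTheta1 n, -1, ε),
          (pauliTheta2 n, 1, 1), (pauliTheta3 n, ε ^ (n / 4), ε)])) ∧
    -- numbers of isomorphism classes
    (∀ τ : Matrix.GeneralLinearGroup (Fin 2) (ZMod n),
      τ.val.det = -1 → τ.val.trace = 0 →
      (Odd n → numIsoClasses 𝒜 τ.val.mulVec = 1) ∧
      (Even n → ¬ 4 ∣ n →
        (SLConj τ.val (pauliTheta1 n) → numIsoClasses 𝒜 τ.val.mulVec = 4) ∧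
        (SLConj τ.val (pauliTheta2 n) → numIsoClasses 𝒜 τ.val.mulVec = 1)) ∧
      (4 ∣ n →
        (SLConj τ.val (pauliTheta1 n) → numIsoClasses 𝒜 τ.val.mulVec = 4) ∧
        (SLConj τ.val (pauliTheta2 n) → numIsoClasses 𝒜 τ.val.mulVec = 1) ∧
        (SLConj τ.val (pauliTheta3 n) → numIsoClasses 𝒜 τ.val.mulVec = 1))) := by
  have hD : Module.finrank F (Matrix (Fin n) (Fin n) F) = n ^ 2 := by
    simp [Module.finrank_matrix, sq]
  -- Existence and the class counts do not mention generators, so one choice serves for all of them.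
  obtain ⟨ε, X, Y, h⟩ := exists_isPauliGenerators hD hdiv hsupp
  have hodd (hn : Odd n) {τ : Matrix (Fin 2) (Fin 2) (ZMod n)} (hd : τ.det = -1)
      (ht : τ.trace = 0) : SLConj τ (pauliTheta1 n) := by
    obtain ⟨x, y, z, rfl, e⟩ := exists_eq_of_trace_eq_zero hd ht
    exact slConj_theta1_of_odd hn e
  refine ⟨fun τ hd ht => ?_, ⟨ε, X, Y, h⟩, fun ε X Y h => ⟨?_, ?_, ?_⟩, fun τ hd ht =>
    ⟨fun hn => ?_, fun hn h4 => ⟨fun hτ => ?_, fun hτ => ?_⟩,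
      fun h4 => ⟨fun hτ => ?_, fun hτ => ?_, fun hτ => ?_⟩⟩⟩
  · exact h.exists_isTauInvolution hD hd ht
  · exact h.hasNormalForms_of_odd hD
  · exact h.hasNormalForms_of_even hD
  · exact h.hasNormalForms_of_four_dvd hD
  · rw [h.numIsoClasses_eq_of_slConj hD (hodd hn hd ht), h.numIsoClasses_theta1_of_odd hD hn]
  · obtain ⟨m, hm⟩ := hn.two_dvd
    rw [h.numIsoClasses_eq_of_slConj hD hτ, h.numIsoClasses_theta1_of_even hD hm]
  · rw [h.numIsoClasses_eq_of_slConj hD hτ, h.numIsoClasses_theta2 hD]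
  · obtain ⟨m, hm⟩ := (Dvd.dvd.trans (by norm_num) h4 : 2 ∣ n)
    rw [h.numIsoClasses_eq_of_slConj hD hτ, h.numIsoClasses_theta1_of_even hD hm]
  · rw [h.numIsoClasses_eq_of_slConj hD hτ, h.numIsoClasses_theta2 hD]
  · rw [h.numIsoClasses_eq_of_slConj hD hτ, h.numIsoClasses_theta3 hD h4]
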